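/- Let $F$ be a field, $N\ge 1$ an integer and $q\in F$ a primitive $N$-th root of unity. Let $T=T_{N,q}$ be the Taft algebra: the unital associative $F$-algebra generated by $a,x$ with relations $a^N=1$, $x^N=0$, $xa=q\,ax$, with the Hopf algebra structure $\Delta(a)=a\otimes a$, $\Delta(x)=x\otimes 1+a\otimes x$, $\varepsilon(a)=1$, $\varepsilon(x)=0$, $S(a)=a^{-1}$, $S(x)=-a^{-1}x$. Let $T^*$ be the dual space with the convolution product $\langle fg,h\rangle=\langle f\otimes g,\Delta(h)\rangle$, and let $D(T)$ be the Drinfeld double, i.e. the algebra on the vector space $T^*\otimes T$ with unit $\varepsilon\otimes 1$ and product $$(f\otimes h)(g\otimes k)=\sum f\,g\bigl(S^{-1}(h_{(3)})\,?\,h_{(1)}\bigr)\otimes h_{(2)}k ,$$ in which $h\in T$ is identified with $\varepsilon\otimes h$ and $f\in T^*$ with $f\otimes 1$. For $p\in\mathbb Z$ put $A^p=\mathrm{span}\{a^ix^p\mid 0\le i<N\}$ if $0\le p<N$, and $A^p=0$ otherwise. Then: 1. $T=\bigoplus_{p\in\mathbb Z}A^p$ is a $\mathbb Z$-grading of the algebra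 $T$ (so $1\in A^0$ and $A^pA^r\subseteq A^{p+r}$), and it is nontrivial (some $A^p\ne 0$ with $p\neq 0$) if $N\ge 2$. 2. $\Delta(A^p)\subseteq\sum_{r\in\mathbb Z}A^r\otimes A^{p-r}$ for all $p\in\mathbb Z$. 3. The elements $a^ix^j$ with $0\le i,j<N$ form a basis of $T$; and if $(a^ix^j)^*$ denotes the dual basis of $T^*$, then $$R(\mu)=\sum_{i,j=0}^{N-1}\mu^j\,a^ix^j\otimes(a^ix^j)^*\in D(T)\otimes D(T)$$ satisfies the multiplicative parametric Yang–Baxter equation $$R_{12}(\mu)R_{13}(\mu\nu)R_{23}(\nu)=R_{23}(\nu)R_{13}(\mu\nu)R_{12}(\mu)\qquad\text{for all }\mu,\nu\in F .$$ -/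

import Mathlib

open scoped TensorProduct

noncomputable section

/-- Hopf algebras with bijective antipode. -/
class HasBijectiveAntipode (F H : Type*) [Field F] [Ring H] [HopfAlgebra F H] : Prop where
  bijective : Function.Bijective (HopfAlgebra.antipode F : H →ₗ[F] H)

section Double

variable (F H : Type*) [Field F] [Ring H] [HopfAlgebra F H]

/-- The dual `H*` with the convolution product `⟨f g, h⟩ = ⟨f ⊗ g, Δ h⟩`. -/
abbrev ConvDual : Type _ := WithConv (H →ₗ[F] F)

section Coassoc

variable (F C : Type*) [Field F] [AddCommGroup C] [Module F C] [Coalgebra F C]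

open Coalgebra in
lemma comul_comul_eq :
    TensorProduct.map (comul (R := F) (A := C)) (comul (R := F) (A := C)) ∘ₗ comul =
      (TensorProduct.assoc F C C (C ⊗[F] C)).symm.toLinearMap ∘ₗ
        (TensorProduct.assoc F C C C).toLinearMap.lTensor C ∘ₗ
          (comul.rTensor C).lTensor C ∘ₗ comul.lTensor C ∘ₗ comul := by
  simp only [coassoc_simps]

/-- The iterated coproduct `h ↦ h₁ ⊗ (h₂ ⊗ h₃)`. -/
def comul₃ : C →ₗ[F] C ⊗[F] (C ⊗[F] C) :=
  Coalgebra.comul.lTensor C ∘ₗ Coalgebra.comul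

/-- The rebracketing `a ⊗ ((b ⊗ (c ⊗ d)) ⊗ e) ↦ (a ⊗ b) ⊗ (c ⊗ (d ⊗ e))`. -/
def rebracket : C ⊗[F] ((C ⊗[F] (C ⊗[F] C)) ⊗[F] C) →ₗ[F]
    (C ⊗[F] C) ⊗[F] (C ⊗[F] (C ⊗[F] C)) :=
  (TensorProduct.assoc F C C _).symm.toLinearMap ∘ₗ
    ((TensorProduct.assoc F C C C).toLinearMap.lTensor C ∘ₗ
      (TensorProduct.assoc F C (C ⊗[F] C) C).toLinearMap).lTensor C

lemma comul₃_nested :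
    rebracket F C ∘ₗ TensorProduct.map LinearMap.id
      (TensorProduct.map (comul₃ F C) LinearMap.id) ∘ₗ comul₃ F C =
    TensorProduct.map Coalgebra.comul (TensorProduct.map LinearMap.id Coalgebra.comul) ∘ₗ
      comul₃ F C := by
  simp only [rebracket, comul₃, coassoc_simps]

end Coassoc

section Antipode

lemma antipode_conv_left :
    WithConv.toConv ((TensorProduct.map (HopfAlgebra.antipode F) (HopfAlgebra.antipode F)) ∘ₗ
      (TensorProduct.comm F H H).toLinearMap ∘ₗ (Coalgebra.comul : H →ₗ[F] H ⊗[F] H)) *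
    WithConv.toConv (Coalgebra.comul : H →ₗ[F] H ⊗[F] H) = 1 := by
  let S : H →ₗ[F] H := HopfAlgebra.antipode F
  let δ : H →ₗ[F] H ⊗[F] H := Coalgebra.comul
  let G : H ⊗[F] H →ₗ[F] H ⊗[F] H := TensorProduct.map S S ∘ₗ (TensorProduct.comm F H H).toLinearMap
  let K : H ⊗[F] H →ₗ[F] H := LinearMap.mul' F H ∘ₗ S.rTensor H
  let Θ : H ⊗[F] (H ⊗[F] H) →ₗ[F] H ⊗[F] H :=
    K.lTensor H ∘ₗ (TensorProduct.leftComm F H H H).toLinearMap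
  have hK : K ∘ₗ δ = Algebra.linearMap F H ∘ₗ Coalgebra.counit := by
    ext h; exact HopfAlgebra.mul_antipode_rTensor_comul_apply h
  have key : LinearMap.mul' F (H ⊗[F] H) ∘ₗ TensorProduct.map G LinearMap.id ∘ₗ
      (TensorProduct.assoc F H H (H ⊗[F] H)).symm.toLinearMap ∘ₗ
      (TensorProduct.assoc F H H H).toLinearMap.lTensor H =
      Θ ∘ₗ (K.rTensor H).lTensor H := by
    ext x y z w
    simp [G, Θ, K]
  have hsplit : TensorProduct.map (G ∘ₗ δ) δ ∘ₗ δ =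
      TensorProduct.map G LinearMap.id ∘ₗ (TensorProduct.map δ δ ∘ₗ δ) := by
    simp only [← LinearMap.comp_assoc, ← TensorProduct.map_comp, LinearMap.id_comp]
  have hε : (K ∘ₗ δ).rTensor H ∘ₗ δ = TensorProduct.mk F H H 1 := by
    rw [hK, LinearMap.rTensor_comp, LinearMap.comp_assoc, Coalgebra.rTensor_counit_comp_comul]
    ext h; simp
  apply WithConv.ext
  change LinearMap.mul' F (H ⊗[F] H) ∘ₗ TensorProduct.map (G ∘ₗ δ) δ ∘ₗ δ =
    Algebra.linearMap F (H ⊗[F] H) ∘ₗ Coalgebra.counit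
  rw [hsplit, comul_comul_eq F H]
  calc _ = (LinearMap.mul' F (H ⊗[F] H) ∘ₗ TensorProduct.map G LinearMap.id ∘ₗ
      (TensorProduct.assoc F H H (H ⊗[F] H)).symm.toLinearMap ∘ₗ
      (TensorProduct.assoc F H H H).toLinearMap.lTensor H) ∘ₗ
        (δ.rTensor H).lTensor H ∘ₗ δ.lTensor H ∘ₗ δ := by
        simp only [LinearMap.comp_assoc]; rfl
    _ = Θ ∘ₗ ((K ∘ₗ δ).rTensor H ∘ₗ δ).lTensor H ∘ₗ δ := by
        rw [key]; simp only [LinearMap.comp_assoc, LinearMap.lTensor_comp, LinearMap.rTensor_comp]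
    _ = TensorProduct.mk F H H 1 ∘ₗ K ∘ₗ δ := by
        rw [hε, ← LinearMap.comp_assoc, ← LinearMap.comp_assoc]
        congr 1
        ext x y
        simp [Θ]
    _ = _ := by
        rw [hK]
        ext h
        simp [Algebra.algebraMap_eq_smul_one, TensorProduct.smul_tmul',
          Algebra.TensorProduct.one_def]

lemma comul_antipode (h : H) :
    Coalgebra.comul (R := F) (HopfAlgebra.antipode F h) =
      TensorProduct.map (HopfAlgebra.antipode F) (HopfAlgebra.antipode F)
        (TensorProduct.comm F H H (Coalgebra.comul h)) := by
  have := left_inv_eq_right_inv (antipode_conv_left F H) (LinearMap.comul_right_inv (R := F) (C := H))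
  exact (congrArg (fun f => f.ofConv h) this).symm

variable [HasBijectiveAntipode F H]

/-- The inverse of the antipode. -/
def antipodeInv : H →ₗ[F] H :=
  (LinearEquiv.ofBijective (HopfAlgebra.antipode F : H →ₗ[F] H)
    HasBijectiveAntipode.bijective).symm.toLinearMap

@[simp] lemma antipode_antipodeInv (h : H) : HopfAlgebra.antipode F (antipodeInv F H h) = h :=
  (LinearEquiv.ofBijective (HopfAlgebra.antipode F : H →ₗ[F] H)
    HasBijectiveAntipode.bijective).apply_symm_apply h

lemma antipodeInv_one : antipodeInv F H 1 = 1 :=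
  (HasBijectiveAntipode.bijective (F := F) (H := H)).1 (by simp)

lemma antipodeInv_mul (a b : H) :
    antipodeInv F H (a * b) = antipodeInv F H b * antipodeInv F H a :=
  (HasBijectiveAntipode.bijective (F := F) (H := H)).1
    (by simp [HopfAlgebra.antipode_mul_antidistrib])

lemma counit_antipodeInv (h : H) :
    Coalgebra.counit (R := F) (antipodeInv F H h) = Coalgebra.counit h := by
  rw [← HopfAlgebra.counit_antipode (R := F), antipode_antipodeInv]

lemma comul_antipodeInv (h : H) :
    Coalgebra.comul (R := F) (antipodeInv F H h) =
      TensorProduct.map (antipodeInv F H) (antipodeInv F H)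
        (TensorProduct.comm F H H (Coalgebra.comul h)) := by
  have hb := HasBijectiveAntipode.bijective (F := F) (H := H)
  let e := LinearEquiv.ofBijective (HopfAlgebra.antipode F : H →ₗ[F] H) hb
  have hi : Function.Injective (TensorProduct.map (HopfAlgebra.antipode F : H →ₗ[F] H)
      (HopfAlgebra.antipode F)) := (TensorProduct.congr e e).injective
  have hS : (HopfAlgebra.antipode F : H →ₗ[F] H) ∘ₗ antipodeInv F H = LinearMap.id := by
    ext; simp
  apply (TensorProduct.comm F H H).injective
  apply hi
  rw [TensorProduct.map_comm, TensorProduct.map_comm, TensorProduct.map_map, hS,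
    ← TensorProduct.map_comm, ← comul_antipode, antipode_antipodeInv]
  simp

end Antipode

section Factors

/-- Left multiplication of `H*` on the first factor of `H* ⊗ H`. -/
def dualMulLeft : ConvDual F H →ₐ[F] Module.End F (ConvDual F H ⊗[F] H) :=
  AlgHom.ofLinearMap
    { toFun := fun f => (LinearMap.mulLeft F f).rTensor H
      map_add' := fun f g => by
        rw [← LinearMap.rTensor_add]; congr 1; ext1 h; exact add_mul f g h
      map_smul' := fun r f => by
        rw [RingHom.id_apply, ← LinearMap.rTensor_smul]; congr 1; ext1 h; exact smul_mul_assoc r f h }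
    (by
      change (LinearMap.mulLeft F (1 : ConvDual F H)).rTensor H = 1
      rw [LinearMap.mulLeft_one]; exact LinearMap.rTensor_id _ _)
    (fun f g => by
      change (LinearMap.mulLeft F (f * g)).rTensor H =
        (LinearMap.mulLeft F f).rTensor H ∘ₗ (LinearMap.mulLeft F g).rTensor H
      rw [← LinearMap.rTensor_comp]; congr 1; ext1 h; exact mul_assoc f g h)

@[simp] lemma dualMulLeft_tmul (f g : ConvDual F H) (b : H) :
    dualMulLeft F H f (g ⊗ₜ b) = (f * g) ⊗ₜ b := rfl

/-- The iterated coproduct as an algebra homomorphism. -/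
def comul₃AlgHom : H →ₐ[F] H ⊗[F] (H ⊗[F] H) :=
  (Algebra.TensorProduct.map (AlgHom.id F H) (Bialgebra.comulAlgHom F H)).comp
    (Bialgebra.comulAlgHom F H)

lemma comul₃AlgHom_apply (a : H) : comul₃AlgHom F H a = comul₃ F H a := rfl

end Factors

section Multiplication

variable [HasBijectiveAntipode F H]

/-- The functional `y ↦ f (S⁻¹(c) y a)`. -/
def conjFunctional (a c : H) : ConvDual F H →ₗ[F] ConvDual F H where
  toFun f := WithConv.toConv
    (f.ofConv ∘ₗ LinearMap.mulLeft F (antipodeInv F H c) ∘ₗ LinearMap.mulRight F a)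
  map_add' _ _ := rfl
  map_smul' _ _ := rfl

@[simp] lemma conjFunctional_apply (a c : H) (f : ConvDual F H) (y : H) :
    conjFunctional F H a c f y = f (antipodeInv F H c * (y * a)) := rfl

/-- The algebra homomorphism `a ⊗ (b ⊗ c) ↦ (f ⊗ d ↦ f(S⁻¹(c) ? a) ⊗ b d)`. -/
def straighten : H ⊗[F] (H ⊗[F] H) →ₐ[F] Module.End F (ConvDual F H ⊗[F] H) :=
  Algebra.TensorProduct.lift
    (AlgHom.ofLinearMap
      { toFun := fun a => (conjFunctional F H a 1).rTensor H
        map_add' := fun a b => by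
          rw [← LinearMap.rTensor_add]; congr 1; ext f y; simp [mul_add]
        map_smul' := fun r a => by
          rw [RingHom.id_apply, ← LinearMap.rTensor_smul]; congr 1; ext f y; simp }
      (by
        change (conjFunctional F H 1 1).rTensor H = 1
        have : conjFunctional F H 1 1 = LinearMap.id := by
          ext f y; simp [antipodeInv_one]
        rw [this]; exact LinearMap.rTensor_id _ _)
      (fun a b => by
        change (conjFunctional F H (a * b) 1).rTensor H =
          (conjFunctional F H a 1).rTensor H ∘ₗ (conjFunctional F H b 1).rTensor H
        rw [← LinearMap.rTensor_comp]; congr 1; ext f y; simp [antipodeInv_one, mul_assoc]))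
    (Algebra.TensorProduct.lift
      (AlgHom.ofLinearMap
        { toFun := fun b => (LinearMap.mulLeft F b).lTensor (ConvDual F H)
          map_add' := fun a b => by
            rw [← LinearMap.lTensor_add]; congr 1; ext y; simp [add_mul]
          map_smul' := fun r a => by
            rw [RingHom.id_apply, ← LinearMap.lTensor_smul]; congr 1; ext y; simp }
        (by
          change (LinearMap.mulLeft F (1 : H)).lTensor (ConvDual F H) = 1
          rw [LinearMap.mulLeft_one]; exact LinearMap.lTensor_id _ _)
        (fun a b => by
          change (LinearMap.mulLeft F (a * b)).lTensor (ConvDual F H) =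
            (LinearMap.mulLeft F a).lTensor (ConvDual F H) ∘ₗ
              (LinearMap.mulLeft F b).lTensor (ConvDual F H)
          rw [← LinearMap.lTensor_comp]; congr 1; ext y; simp))
      (AlgHom.ofLinearMap
        { toFun := fun c => (conjFunctional F H 1 c).rTensor H
          map_add' := fun a b => by
            rw [← LinearMap.rTensor_add]; congr 1; ext f y; simp [add_mul]
          map_smul' := fun r a => by
            rw [RingHom.id_apply, ← LinearMap.rTensor_smul]; congr 1; ext f y; simp }
        (by
          change (conjFunctional F H 1 1).rTensor H = 1
          have : conjFunctional F H 1 1 = LinearMap.id := by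
            ext f y; simp [antipodeInv_one]
          rw [this]; exact LinearMap.rTensor_id _ _)
        (fun a b => by
          change (conjFunctional F H 1 (a * b)).rTensor H =
            (conjFunctional F H 1 a).rTensor H ∘ₗ (conjFunctional F H 1 b).rTensor H
          rw [← LinearMap.rTensor_comp]; congr 1; ext f y; simp [antipodeInv_mul, mul_assoc]))
      (fun b c => by
        change _ ∘ₗ _ = _ ∘ₗ _
        ext f d; simp))
    (fun a w => by
      induction w with
      | zero => simp
      | add x y hx hy => rw [map_add]; exact hx.add_right hy
      | tmul b c =>
        change _ ∘ₗ _ = _ ∘ₗ _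
        apply TensorProduct.ext'
        intro f d
        simp
        congr 1
        ext y; simp [antipodeInv_one, mul_assoc])

lemma straighten_tmul (a b c d : H) (f : ConvDual F H) :
    straighten F H (a ⊗ₜ (b ⊗ₜ c)) (f ⊗ₜ d) = conjFunctional F H a c f ⊗ₜ (b * d) := by
  simp [straighten]
  congr 1
  ext y; simp [antipodeInv_one]

/-- The operator `a ↦ (f ⊗ d ↦ ∑ f(S⁻¹(a₃) ? a₁) ⊗ a₂ d)` on `H* ⊗ H`. -/
def crossLeft : H →ₐ[F] Module.End F (ConvDual F H ⊗[F] H) :=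
  (straighten F H).comp (comul₃AlgHom F H)

/-- The multiplication of the Drinfeld double on `H* ⊗ H`, as the map sending `u` to left
multiplication by `u`:
`(f ⊗ a) (g ⊗ b) = ∑ f g(S⁻¹(a₃) ? a₁) ⊗ a₂ b`. -/
def doubleMul : ConvDual F H ⊗[F] H →ₗ[F] Module.End F (ConvDual F H ⊗[F] H) :=
  LinearMap.mul' F _ ∘ₗ
    TensorProduct.map (dualMulLeft F H).toLinearMap (crossLeft F H).toLinearMap

lemma doubleMul_tmul (f : ConvDual F H) (a : H) (v : ConvDual F H ⊗[F] H) :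
    doubleMul F H (f ⊗ₜ a) v = dualMulLeft F H f (crossLeft F H a v) := rfl

/-- `conjFunctional` as a linear map `a ⊗ c ↦ f(S⁻¹(c) ? a)`. -/
def conjTensor (f : ConvDual F H) : H ⊗[F] H →ₗ[F] ConvDual F H :=
  TensorProduct.lift (LinearMap.mk₂ F (fun a c => conjFunctional F H a c f)
    (fun a a' c => by ext y; simp [mul_add]) (fun r a c => by ext y; simp)
    (fun a c c' => by ext y; simp [add_mul]) (fun r a c => by ext y; simp))

/-- `X ⊗ Z ↦ (y ↦ (f ⊗ g)((S⁻¹ ⊗ S⁻¹)(Zᵒᵖ) Δ(y) X))`. -/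
def conjTensor₂ (f g : ConvDual F H) : (H ⊗[F] H) ⊗[F] (H ⊗[F] H) →ₗ[F] ConvDual F H :=
  TensorProduct.lift (LinearMap.mk₂ F (fun X Z => WithConv.toConv
      (LinearMap.mul' F F ∘ₗ TensorProduct.map f.ofConv g.ofConv ∘ₗ
        LinearMap.mulLeft F (TensorProduct.map (antipodeInv F H) (antipodeInv F H)
          (TensorProduct.comm F H H Z)) ∘ₗ LinearMap.mulRight F X ∘ₗ Coalgebra.comul))
    (fun a a' c => by ext y; simp [mul_add]) (fun r a c => by ext y; simp)
    (fun a c c' => by ext y; simp [add_mul]) (fun r a c => by ext y; simp))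

lemma conjTensor₂_tmul (f g : ConvDual F H) (x x' z z' : H) :
    conjTensor₂ F H f g ((x ⊗ₜ x') ⊗ₜ (z ⊗ₜ z')) =
      conjFunctional F H x z' f * conjFunctional F H x' z g := by
  ext y
  simp only [conjTensor₂, LinearMap.convMul_apply]
  simp
  generalize (Coalgebra.comul y : H ⊗[F] H) = w
  induction w with
  | zero => simp
  | add u v hu hv => simp only [add_mul, mul_add, map_add, hu, hv]
  | tmul u v => simp

lemma conjTensor₂_comul (f g : ConvDual F H) (x z : H) :
    conjTensor₂ F H f g (Coalgebra.comul x ⊗ₜ Coalgebra.comul z) =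
      conjFunctional F H x z (f * g) := by
  ext y
  simp only [conjTensor₂, conjFunctional_apply, LinearMap.convMul_apply]
  simp [← comul_antipodeInv]

lemma crossLeft_dualMulLeft (a : H) (g : ConvDual F H) (b : H) :
    doubleMul F H (crossLeft F H a (g ⊗ₜ b)) =
      crossLeft F H a * dualMulLeft F H g * crossLeft F H b := by
  let σ (M N P : Type _) [AddCommGroup M] [AddCommGroup N] [AddCommGroup P] [Module F M]
      [Module F N] [Module F P] : M ⊗[F] (N ⊗[F] P) →ₗ[F] (M ⊗[F] P) ⊗[F] N :=
    (TensorProduct.assoc F M P N).symm.toLinearMap ∘ₗ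
      (TensorProduct.comm F N P).toLinearMap.lTensor M
  have hb : ∀ w : H ⊗[F] (H ⊗[F] H), doubleMul F H (straighten F H w (g ⊗ₜ b)) =
      doubleMul F H (straighten F H w (g ⊗ₜ 1)) * crossLeft F H b := by
    intro w
    have : (doubleMul F H ∘ₗ LinearMap.applyₗ (g ⊗ₜ[F] b) ∘ₗ (straighten F H).toLinearMap) =
        LinearMap.mulRight F (crossLeft F H b) ∘ₗ
        (doubleMul F H ∘ₗ LinearMap.applyₗ (g ⊗ₜ[F] (1 : H)) ∘ₗ (straighten F H).toLinearMap) := by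
      apply TensorProduct.ext'
      intro x w
      induction w with
      | zero => simp
      | add u v hu hv => rw [TensorProduct.tmul_add, map_add, map_add, hu, hv]
      | tmul y z =>
        simp only [LinearMap.comp_apply, LinearMap.applyₗ_apply_apply, AlgHom.toLinearMap_apply,
          straighten_tmul, LinearMap.mulRight_apply, mul_one]
        apply LinearMap.ext
        intro v
        simp [doubleMul_tmul]
    exact LinearMap.congr_fun this w
  change doubleMul F H (straighten F H (comul₃ F H a) (g ⊗ₜ b)) = _
  rw [hb]
  congr 1
  apply TensorProduct.ext'
  intro h c
  let act : ConvDual F H ⊗[F] (ConvDual F H ⊗[F] H) →ₗ[F] ConvDual F H ⊗[F] H :=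
    TensorProduct.lift (dualMulLeft F H).toLinearMap
  let Ψ : H ⊗[F] ((H ⊗[F] (H ⊗[F] H)) ⊗[F] H) →ₗ[F] ConvDual F H ⊗[F] H :=
    act ∘ₗ TensorProduct.map (conjTensor F H g)
      (LinearMap.applyₗ (h ⊗ₜ[F] c) ∘ₗ (straighten F H).toLinearMap) ∘ₗ σ _ _ _
  let Ξ : (H ⊗[F] H) ⊗[F] (H ⊗[F] (H ⊗[F] H)) →ₗ[F] ConvDual F H ⊗[F] H :=
    TensorProduct.map (conjTensor₂ F H g h) (LinearMap.mulRight F c) ∘ₗ σ _ _ _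
  have h1 : Ψ = Ξ ∘ₗ rebracket F H := by
    apply TensorProduct.ext'
    intro x w
    induction w with
    | zero => simp
    | add u v hu hv => rw [TensorProduct.tmul_add, map_add, map_add, hu, hv]
    | tmul w z =>
      induction w with
      | zero => simp
      | add u v hu hv =>
        rw [TensorProduct.add_tmul, TensorProduct.tmul_add, map_add, map_add, hu, hv]
      | tmul p w =>
        induction w with
        | zero => simp
        | add u v hu hv =>
          rw [TensorProduct.tmul_add, TensorProduct.add_tmul, TensorProduct.tmul_add, map_add,
            map_add, hu, hv]
        | tmul q r =>
          simp [Ψ, Ξ, σ, act, rebracket, straighten_tmul, conjTensor₂_tmul, conjTensor]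
  have h2 : ∀ w, Ψ (TensorProduct.map LinearMap.id
      (TensorProduct.map (comul₃ F H) LinearMap.id) w) =
      doubleMul F H (straighten F H w (g ⊗ₜ 1)) (h ⊗ₜ c) := by
    intro w
    induction w with
    | zero => simp
    | add u v hu hv => simp only [map_add, hu, hv, LinearMap.add_apply]
    | tmul x w =>
      induction w with
      | zero => simp
      | add u v hu hv => simp only [TensorProduct.tmul_add, map_add, hu, hv, LinearMap.add_apply]
      | tmul y z =>
        rw [straighten_tmul, mul_one, doubleMul_tmul]
        simp [Ψ, σ, act, conjTensor, crossLeft, comul₃AlgHom_apply]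
  have h3 : ∀ w, Ξ (TensorProduct.map Coalgebra.comul
      (TensorProduct.map LinearMap.id Coalgebra.comul) w) =
      straighten F H w ((g * h) ⊗ₜ c) := by
    intro w
    induction w with
    | zero => simp
    | add u v hu hv => simp only [map_add, hu, hv, LinearMap.add_apply]
    | tmul x w =>
      induction w with
      | zero => simp
      | add u v hu hv => simp only [TensorProduct.tmul_add, map_add, hu, hv, LinearMap.add_apply]
      | tmul y z =>
        rw [straighten_tmul]
        simp [Ξ, σ, conjTensor₂_comul]
  rw [← h2, Module.End.mul_apply, dualMulLeft_tmul]
  change _ = straighten F H (comul₃ F H a) _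
  rw [← h3, h1]
  exact congrArg Ξ (LinearMap.congr_fun (comul₃_nested F H) a)

lemma doubleMul_one (v : ConvDual F H ⊗[F] H) : doubleMul F H (1 ⊗ₜ 1) v = v := by
  rw [doubleMul_tmul, map_one, map_one]; rfl

lemma doubleMul_doubleMul (u v : ConvDual F H ⊗[F] H) :
    doubleMul F H (doubleMul F H u v) = doubleMul F H u * doubleMul F H v := by
  induction u with
  | zero => simp
  | add u u' hu hu' => simp only [map_add, LinearMap.add_apply, hu, hu', add_mul]
  | tmul f a =>
    induction v with
    | zero => simp
    | add v v' hv hv' => simp only [map_add, hv, hv', mul_add]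
    | tmul g b =>
      have hL : ∀ w, doubleMul F H (dualMulLeft F H f w) = dualMulLeft F H f * doubleMul F H w := by
        intro w
        induction w with
        | zero => simp
        | add u v hu hv => simp only [map_add, hu, hv, mul_add]
        | tmul h c =>
          ext1
          simp [doubleMul, mul_assoc]
      rw [doubleMul_tmul, hL, crossLeft_dualMulLeft]
      simp [doubleMul, mul_assoc]

lemma doubleMul_apply_one (v : ConvDual F H ⊗[F] H) : doubleMul F H v (1 ⊗ₜ 1) = v := by
  induction v with
  | zero => simp
  | add u v hu hv => simp only [map_add, LinearMap.add_apply, hu, hv]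
  | tmul f a =>
    have key : ∀ w : H ⊗[F] (H ⊗[F] H), straighten F H w ((1 : ConvDual F H) ⊗ₜ[F] (1 : H)) =
        (1 : ConvDual F H) ⊗ₜ (TensorProduct.lid F H (TensorProduct.map Coalgebra.counit
          ((TensorProduct.rid F H).toLinearMap ∘ₗ Coalgebra.counit.lTensor H) w)) := by
      intro w
      induction w with
      | zero => simp
      | add u v hu hv =>
        simp only [map_add, TensorProduct.tmul_add, hu, hv, LinearMap.add_apply]
      | tmul x w =>
        induction w with
        | zero => simp
        | add u v hu hv =>
          simp only [TensorProduct.tmul_add, map_add, hu, hv, LinearMap.add_apply]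
        | tmul y z =>
          rw [straighten_tmul]
          have : conjFunctional F H x z 1 =
              (Coalgebra.counit (R := F) x * Coalgebra.counit (R := F) z) •
                (1 : ConvDual F H) := by
            ext y
            simp [counit_antipodeInv]
            ring
          rw [this]
          simp only [mul_one, TensorProduct.map_tmul, LinearMap.comp_apply,
            LinearMap.lTensor_tmul, LinearEquiv.coe_coe, TensorProduct.rid_tmul,
            TensorProduct.lid_tmul, smul_smul]
          exact TensorProduct.smul_tmul _ _ _
    have h3 : ((TensorProduct.lid F H).toLinearMap ∘ₗ TensorProduct.map Coalgebra.counit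
          ((TensorProduct.rid F H).toLinearMap ∘ₗ Coalgebra.counit.lTensor H)) ∘ₗ comul₃ F H =
        LinearMap.id := by
      have e : TensorProduct.map (Coalgebra.counit (R := F) (A := H))
          ((TensorProduct.rid F H).toLinearMap ∘ₗ Coalgebra.counit.lTensor H) ∘ₗ comul₃ F H =
          (Coalgebra.counit (R := F) (A := H)).rTensor H ∘ₗ
          ((TensorProduct.rid F H).toLinearMap ∘ₗ
            Coalgebra.counit.lTensor H ∘ₗ Coalgebra.comul).lTensor H ∘ₗ Coalgebra.comul := by
        simp only [comul₃, ← LinearMap.comp_assoc, LinearMap.rTensor, LinearMap.lTensor,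
          ← TensorProduct.map_comp, LinearMap.id_comp, LinearMap.comp_id]
      rw [LinearMap.comp_assoc, e, Coalgebra.lTensor_counit_comp_comul]
      have e2 : (TensorProduct.rid F H).toLinearMap ∘ₗ (TensorProduct.mk F H F).flip 1 =
          LinearMap.id := by
        ext; simp
      rw [e2, LinearMap.lTensor_id, LinearMap.id_comp, Coalgebra.rTensor_counit_comp_comul]
      ext; simp
    rw [doubleMul_tmul]
    change dualMulLeft F H f (straighten F H (comul₃ F H a) _) = _
    rw [key]
    have := LinearMap.congr_fun h3 a
    simp only [LinearMap.comp_apply, LinearEquiv.coe_coe, LinearMap.id_apply] at this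
    erw [this]
    simp

end Multiplication

section Algebra

variable [HasBijectiveAntipode F H]

/-- The Drinfeld double `D(H)`: the space `H* ⊗ H` with the multiplication
`(f ⊗ a) (g ⊗ b) = ∑ f g(S⁻¹(a₃) ? a₁) ⊗ a₂ b`, where `H*` carries the convolution product. -/
def DrinfeldDouble : Type _ := ConvDual F H ⊗[F] H

namespace DrinfeldDouble

instance : AddCommGroup (DrinfeldDouble F H) :=
  inferInstanceAs (AddCommGroup (ConvDual F H ⊗[F] H))

instance : Module F (DrinfeldDouble F H) :=
  inferInstanceAs (Module F (ConvDual F H ⊗[F] H))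

instance : Ring (DrinfeldDouble F H) where
  __ := (inferInstance : AddCommGroup (DrinfeldDouble F H))
  mul u v := doubleMul F H u v
  one := ((1 : ConvDual F H) ⊗ₜ[F] (1 : H) : ConvDual F H ⊗[F] H)
  mul_assoc u v w := congrArg (fun T : Module.End F (ConvDual F H ⊗[F] H) => T w)
    (doubleMul_doubleMul F H u v)
  one_mul := doubleMul_one F H
  mul_one := doubleMul_apply_one F H
  left_distrib u v w := map_add (doubleMul F H u) v w
  right_distrib u v w := congrArg (fun T : Module.End F (ConvDual F H ⊗[F] H) => T w)
    (map_add (doubleMul F H) u v)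
  zero_mul u := congrArg (fun T : Module.End F (ConvDual F H ⊗[F] H) => T u)
    (map_zero (doubleMul F H))
  mul_zero u := map_zero (doubleMul F H u)

instance : Algebra F (DrinfeldDouble F H) :=
  Algebra.ofModule
    (fun r u v => congrArg (fun T : Module.End F (ConvDual F H ⊗[F] H) => T v)
      (map_smul (doubleMul F H) r u))
    (fun r u v => map_smul (doubleMul F H u) r v)

variable {F H}

/-- The element `f ⊗ h` of `D(H)`. -/
def tmul (f : ConvDual F H) (h : H) : DrinfeldDouble F H :=
  (f ⊗ₜ[F] h : ConvDual F H ⊗[F] H)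

lemma mul_def (u v : DrinfeldDouble F H) : u * v = doubleMul F H u v := rfl

lemma one_def : (1 : DrinfeldDouble F H) = tmul 1 1 := rfl

/-- The multiplication in Sweedler form. -/
lemma tmul_mul_tmul {ι : Type*} (s : Finset ι) (a₁ a₂ a₃ : ι → H) (f g : ConvDual F H) (a b : H)
    (ha : comul₃ F H a = ∑ i ∈ s, a₁ i ⊗ₜ (a₂ i ⊗ₜ a₃ i)) :
    tmul f a * tmul g b =
      ∑ i ∈ s, tmul (f * conjFunctional F H (a₁ i) (a₃ i) g) (a₂ i * b) := by
  rw [mul_def]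
  change dualMulLeft F H f (straighten F H (comul₃ F H a) (g ⊗ₜ b)) = _
  rw [ha, map_sum, LinearMap.sum_apply, map_sum]
  simp only [straighten_tmul, dualMulLeft_tmul]
  rfl

variable (F H)

/-- The embedding `H → D(H)`, `h ↦ ε ⊗ h`. -/
def ofHopf : H →ₐ[F] DrinfeldDouble F H :=
  AlgHom.ofLinearMap (TensorProduct.mk F (ConvDual F H) H 1) rfl (fun a b => by
    have h : ∀ c : H, crossLeft F H c (1 ⊗ₜ 1) = 1 ⊗ₜ c := fun c => by
      have := doubleMul_apply_one F H ((1 : ConvDual F H) ⊗ₜ[F] c)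
      rwa [doubleMul_tmul, map_one] at this
    change (1 : ConvDual F H) ⊗ₜ[F] (a * b) = doubleMul F H (1 ⊗ₜ a) (1 ⊗ₜ b)
    rw [doubleMul_tmul, map_one, Module.End.one_apply, ← h b, ← Module.End.mul_apply, ← map_mul, h])

/-- The embedding `H* → D(H)`, `f ↦ f ⊗ 1`. -/
def ofDual : ConvDual F H →ₐ[F] DrinfeldDouble F H :=
  AlgHom.ofLinearMap ((TensorProduct.mk F (ConvDual F H) H).flip 1) rfl (fun f g => by
    change (f * g) ⊗ₜ[F] (1 : H) = doubleMul F H (f ⊗ₜ 1) (g ⊗ₜ 1)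
    rw [doubleMul_tmul, map_one, Module.End.one_apply, dualMulLeft_tmul])

lemma ofHopf_apply (h : H) : ofHopf F H h = tmul 1 h := rfl

lemma ofDual_apply (f : ConvDual F H) : ofDual F H f = tmul f 1 := rfl

end DrinfeldDouble

end Algebra

end Double

section QBinomial

variable {F : Type*} [Field F]

/-- The Gaussian binomial coefficient `(i + j choose j)` at `q`. -/
def qBinom (q : F) : ℕ → ℕ → F
  | 0, 0 => 1
  | 0, j + 1 => qBinom q 0 j
  | i + 1, 0 => qBinom q i 0
  | i + 1, j + 1 => qBinom q (i + 1) j + q ^ (j + 1) * qBinom q i (j + 1)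

lemma qBinom_zero_left (q : F) (j : ℕ) : qBinom q 0 j = 1 := by
  induction j with
  | zero => simp [qBinom]
  | succ j ih => simpa [qBinom] using ih

lemma qBinom_zero_right (q : F) (i : ℕ) : qBinom q i 0 = 1 := by
  induction i with
  | zero => simp [qBinom]
  | succ j ih => simpa [qBinom] using ih

lemma qBinom_mul (q : F) (i j : ℕ) :
    qBinom q i j * ((∏ k ∈ Finset.range i, (1 - q ^ (k + 1))) *
      ∏ k ∈ Finset.range j, (1 - q ^ (k + 1))) = ∏ k ∈ Finset.range (i + j), (1 - q ^ (k + 1)) := by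
  induction i generalizing j with
  | zero => simp [qBinom_zero_left]
  | succ i ih =>
    induction j with
    | zero => simp [qBinom_zero_right]
    | succ j ih' =>
      have h := ih (j + 1)
      rw [show i + 1 + (j + 1) = (i + j + 1) + 1 by ring, Finset.prod_range_succ _ (i + j + 1)]
      rw [show i + (j + 1) = i + j + 1 by ring] at h
      rw [show i + 1 + j = i + j + 1 by ring] at ih'
      rw [qBinom]
      have hi := Finset.prod_range_succ (fun k => 1 - q ^ (k + 1)) i
      have hj := Finset.prod_range_succ (fun k => 1 - q ^ (k + 1)) j
      rw [hi] at ih' ⊢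
      rw [hj] at h ⊢
      have e : q ^ (i + j + 1 + 1) = q ^ (j + 1) * q ^ (i + 1) := by ring
      rw [e]
      linear_combination (1 - q ^ (j + 1)) * ih' + q ^ (j + 1) * (1 - q ^ (i + 1)) * h

lemma qBinom_eq_zero {q : F} {N : ℕ} (hq : IsPrimitiveRoot q N) {i j : ℕ} (hi : 0 < i)
    (hj : 0 < j) (h : i + j = N) : qBinom q i j = 0 := by
  have hne : ∀ m < N, ∏ k ∈ Finset.range m, (1 - q ^ (k + 1)) ≠ 0 := by
    intro m hm
    rw [Finset.prod_ne_zero_iff]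
    intro k hk h0
    have : k < m := Finset.mem_range.1 hk
    exact hq.pow_ne_one_of_pos_of_lt (Nat.succ_ne_zero k) (by omega) (sub_eq_zero.1 h0).symm
  have h0 : ∏ k ∈ Finset.range (i + j), (1 - q ^ (k + 1)) = 0 := by
    apply Finset.prod_eq_zero (i := N - 1) (Finset.mem_range.2 (by omega))
    rw [show N - 1 + 1 = N by omega, hq.pow_eq_one, sub_self]
  have := qBinom_mul q i j
  rw [h0] at this
  exact (mul_eq_zero.1 this).resolve_right
    (mul_ne_zero (hne i (by omega)) (hne j (by omega)))

lemma qCommute_pow {A : Type*} [Ring A] [Algebra F A] {q : F} {X Y : A}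
    (h : X * Y = q • (Y * X)) (j : ℕ) : X ^ j * Y = q ^ j • (Y * X ^ j) := by
  induction j with
  | zero => simp
  | succ j ih =>
    rw [pow_succ, mul_assoc, h, mul_smul_comm, ← mul_assoc, ih, smul_mul_assoc, smul_smul,
      mul_assoc, pow_succ' q]

lemma qCommute_pow_right {A : Type*} [Ring A] [Algebra F A] {q : F} {X Y : A}
    (h : X * Y = q • (Y * X)) (j : ℕ) : X * Y ^ j = q ^ j • (Y ^ j * X) := by
  induction j with
  | zero => simp
  | succ j ih =>
    rw [pow_succ, ← mul_assoc, ih, smul_mul_assoc, mul_assoc, h, mul_smul_comm, smul_smul,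
      ← mul_assoc, pow_succ q]

lemma qBinom_theorem {A : Type*} [Ring A] [Algebra F A] {q : F} {X Y : A}
    (h : X * Y = q • (Y * X)) (n : ℕ) :
    (X + Y) ^ n = ∑ p ∈ Finset.HasAntidiagonal.antidiagonal n, qBinom q p.1 p.2 • (Y ^ p.1 * X ^ p.2) := by
  induction n with
  | zero => simp [qBinom]
  | succ n ih =>
    let f₁ : ℕ × ℕ → A := fun p => match p with
      | (_, 0) => 0
      | (i, j + 1) => qBinom q i j • (Y ^ i * X ^ (j + 1))
    let f₂ : ℕ × ℕ → A := fun p => match p with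
      | (0, _) => 0
      | (i + 1, j) => (q ^ j * qBinom q i j) • (Y ^ (i + 1) * X ^ j)
    have hf : ∀ p ∈ Finset.HasAntidiagonal.antidiagonal (n + 1),
        qBinom q p.1 p.2 • (Y ^ p.1 * X ^ p.2) = f₁ p + f₂ p := by
      rintro ⟨i, j⟩ hp
      rcases i with _ | i <;> rcases j with _ | j
      · simp at hp
      · simp [f₁, f₂, qBinom]
      · simp [f₁, f₂, qBinom]
      · simp [f₁, f₂, qBinom, add_smul]
    rw [Finset.sum_congr rfl hf, Finset.sum_add_distrib,
      Finset.Nat.sum_antidiagonal_succ' (f := f₁), Finset.Nat.sum_antidiagonal_succ (f := f₂),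
      pow_succ, ih, Finset.sum_mul]
    simp only [f₁, f₂, zero_add]
    rw [← Finset.sum_add_distrib]
    refine Finset.sum_congr rfl fun p _ => ?_
    rw [mul_add, smul_mul_assoc, smul_mul_assoc, mul_assoc, ← pow_succ, mul_assoc,
      qCommute_pow h, mul_smul_comm, smul_smul, ← mul_assoc, ← pow_succ, mul_comm (q ^ _)]

lemma add_pow_eq_zero_of_qCommute {A : Type*} [Ring A] [Algebra F A] {q : F} {N : ℕ} [NeZero N]
    (hq : IsPrimitiveRoot q N) {X Y : A} (h : X * Y = q • (Y * X)) (hX : X ^ N = 0)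
    (hY : Y ^ N = 0) : (X + Y) ^ N = 0 := by
  rw [qBinom_theorem h]
  refine Finset.sum_eq_zero ?_
  rintro ⟨i, j⟩ hp
  rw [Finset.HasAntidiagonal.mem_antidiagonal] at hp
  simp only at hp ⊢
  rcases Nat.eq_zero_or_pos i with rfl | hi
  · rw [show j = N by omega, hX]; simp
  rcases Nat.eq_zero_or_pos j with rfl | hj
  · rw [show i = N by omega, hY]; simp
  rw [qBinom_eq_zero hq hi hj hp, zero_smul]

end QBinomial

section Taft

/-- Names for the two generators of the Taft algebra. -/
inductive TaftGen
  | a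
  | x

variable (F : Type*) [Field F] (N : ℕ) (q : F)

/-- The defining relations `aᴺ = 1`, `xᴺ = 0`, `x a = q a x`. -/
inductive TaftRel : FreeAlgebra F TaftGen → FreeAlgebra F TaftGen → Prop
  | a_pow : TaftRel (FreeAlgebra.ι F TaftGen.a ^ N) 1
  | x_pow : TaftRel (FreeAlgebra.ι F TaftGen.x ^ N) 0
  | comm : TaftRel (FreeAlgebra.ι F TaftGen.x * FreeAlgebra.ι F TaftGen.a)
      (q • (FreeAlgebra.ι F TaftGen.a * FreeAlgebra.ι F TaftGen.x))

/-- The Taft algebra `T_{N,q}`: the unital associative `F`-algebra generated by `a` and `x`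
subject to `aᴺ = 1`, `xᴺ = 0`, `x a = q a x`. -/
def TaftAlgebra : Type _ := RingQuot (TaftRel F N q)

namespace TaftAlgebra

instance : Ring (TaftAlgebra F N q) := inferInstanceAs (Ring (RingQuot (TaftRel F N q)))

instance : Algebra F (TaftAlgebra F N q) :=
  inferInstanceAs (Algebra F (RingQuot (TaftRel F N q)))

/-- The generator `a`. -/
def a : TaftAlgebra F N q := RingQuot.mkAlgHom F (TaftRel F N q) (FreeAlgebra.ι F TaftGen.a)

/-- The generator `x`. -/
def x : TaftAlgebra F N q := RingQuot.mkAlgHom F (TaftRel F N q) (FreeAlgebra.ι F TaftGen.x)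

lemma a_pow : a F N q ^ N = 1 := by
  have := RingQuot.mkAlgHom_rel F (TaftRel.a_pow (F := F) (N := N) (q := q))
  rw [map_pow, map_one] at this
  exact this

lemma x_pow : x F N q ^ N = 0 := by
  have := RingQuot.mkAlgHom_rel F (TaftRel.x_pow (F := F) (N := N) (q := q))
  rw [map_pow, map_zero] at this
  exact this

lemma x_mul_a : x F N q * a F N q = q • (a F N q * x F N q) := by
  have := RingQuot.mkAlgHom_rel F (TaftRel.comm (F := F) (N := N) (q := q))
  rw [map_mul, map_smul, map_mul] at this
  exact this

variable {F N q}

/-- The algebra homomorphism out of the Taft algebra given by images of the generators that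
satisfy the relations. -/
def lift {A : Type*} [Ring A] [Algebra F A] (α ξ : A) (h₁ : α ^ N = 1) (h₂ : ξ ^ N = 0)
    (h₃ : ξ * α = q • (α * ξ)) : TaftAlgebra F N q →ₐ[F] A :=
  RingQuot.liftAlgHom F (s := TaftRel F N q)
    ⟨FreeAlgebra.lift F (fun g => match g with | TaftGen.a => α | TaftGen.x => ξ), by
      intro u v huv
      cases huv with
      | a_pow => simpa using h₁
      | x_pow => simpa using h₂
      | comm => simpa using h₃⟩

section
variable {A : Type*} [Ring A] [Algebra F A] (α ξ : A) (h₁ : α ^ N = 1) (h₂ : ξ ^ N = 0)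
    (h₃ : ξ * α = q • (α * ξ))

@[simp] lemma lift_a : lift α ξ h₁ h₂ h₃ (a F N q) = α := by
  rw [a, lift]
  erw [RingQuot.liftAlgHom_mkAlgHom_apply]
  simp

@[simp] lemma lift_x : lift α ξ h₁ h₂ h₃ (x F N q) = ξ := by
  rw [x, lift]
  erw [RingQuot.liftAlgHom_mkAlgHom_apply]
  simp
end

lemma induction {p : TaftAlgebra F N q → Prop} (halg : ∀ r, p (algebraMap F _ r))
    (ha : p (a F N q)) (hx : p (x F N q)) (hmul : ∀ s t, p s → p t → p (s * t))
    (hadd : ∀ s t, p s → p t → p (s + t)) (t : TaftAlgebra F N q) : p t := by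
  obtain ⟨t, rfl⟩ := RingQuot.mkAlgHom_surjective F (TaftRel F N q) t
  induction t using FreeAlgebra.induction with
  | grade0 r => rw [AlgHom.commutes]; exact halg r
  | grade1 g => cases g with
    | a => exact ha
    | x => exact hx
  | mul s t hs ht => rw [map_mul]; exact hmul _ _ hs ht
  | add s t hs ht => rw [map_add]; exact hadd _ _ hs ht

lemma algHom_ext {A : Type*} [Ring A] [Algebra F A] {f g : TaftAlgebra F N q →ₐ[F] A}
    (ha : f (a F N q) = g (a F N q)) (hx : f (x F N q) = g (x F N q)) : f = g := by
  ext t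
  induction t using induction with
  | halg r => simp
  | ha => exact ha
  | hx => exact hx
  | hmul s t hs ht => simp [hs, ht]
  | hadd s t hs ht => simp [hs, ht]

lemma exists_smul_pow (k n : ℕ) :
    ∃ c : F, (a F N q ^ k * x F N q) ^ n = c • (a F N q ^ (k * n) * x F N q ^ n) := by
  induction n with
  | zero => exact ⟨1, by simp⟩
  | succ n ih =>
    obtain ⟨c, hc⟩ := ih
    refine ⟨(q ^ n) ^ k * c, ?_⟩
    have h : x F N q ^ n * a F N q ^ k = (q ^ n) ^ k • (a F N q ^ k * x F N q ^ n) :=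
      qCommute_pow_right (qCommute_pow (x_mul_a F N q) n) k
    rw [pow_succ, hc, smul_mul_assoc, mul_assoc, ← mul_assoc (x F N q ^ n), h, smul_mul_assoc,
      mul_smul_comm, smul_smul, mul_comm c, mul_assoc, ← pow_succ, ← mul_assoc, ← pow_add,
      Nat.mul_succ]

variable (F N q) [NeZero N]

lemma a_mul_a_inv : a F N q * a F N q ^ (N - 1) = 1 := by
  rw [← pow_succ', Nat.sub_add_cancel NeZero.one_le, a_pow]

lemma a_inv_mul_a : a F N q ^ (N - 1) * a F N q = 1 := by
  rw [← pow_succ, Nat.sub_add_cancel NeZero.one_le, a_pow]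

variable [hq : Fact (IsPrimitiveRoot q N)]

lemma a_inv_mul_x : a F N q ^ (N - 1) * x F N q = q • (x F N q * a F N q ^ (N - 1)) := by
  rw [qCommute_pow_right (x_mul_a F N q), smul_smul, ← pow_succ',
    Nat.sub_add_cancel NeZero.one_le, hq.out.pow_eq_one, one_smul]

/-- The coproduct: `Δ(a) = a ⊗ a`, `Δ(x) = x ⊗ 1 + a ⊗ x`. -/
def comulHom : TaftAlgebra F N q →ₐ[F] TaftAlgebra F N q ⊗[F] TaftAlgebra F N q :=
  lift (a F N q ⊗ₜ a F N q) (x F N q ⊗ₜ 1 + a F N q ⊗ₜ x F N q)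
    (by simp [Algebra.TensorProduct.tmul_pow, a_pow, Algebra.TensorProduct.one_def])
    (by
      apply add_pow_eq_zero_of_qCommute hq.out
      · simp [Algebra.TensorProduct.tmul_mul_tmul, x_mul_a, TensorProduct.smul_tmul']
      · simp [Algebra.TensorProduct.tmul_pow, x_pow]
      · simp [Algebra.TensorProduct.tmul_pow, x_pow])
    (by
      simp [add_mul, mul_add, Algebra.TensorProduct.tmul_mul_tmul, x_mul_a,
        TensorProduct.smul_tmul', TensorProduct.tmul_smul])

/-- The counit: `ε(a) = 1`, `ε(x) = 0`. -/
def counitHom : TaftAlgebra F N q →ₐ[F] F :=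
  lift 1 0 (by simp) (by simp [NeZero.ne N]) (by simp)

/-- The antipode as an anti-homomorphism: `S(a) = a⁻¹`, `S(x) = -a⁻¹ x`. -/
def antipodeHom : TaftAlgebra F N q →ₐ[F] (TaftAlgebra F N q)ᵐᵒᵖ :=
  lift (MulOpposite.op (a F N q ^ (N - 1))) (MulOpposite.op (-(a F N q ^ (N - 1) * x F N q)))
    (by rw [← MulOpposite.op_pow, ← pow_mul, mul_comm, pow_mul, a_pow, one_pow]; rfl)
    (by
      obtain ⟨c, hc⟩ := exists_smul_pow (F := F) (N := N) (q := q) (N - 1) N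
      rw [← MulOpposite.op_pow, neg_pow, hc, x_pow]; simp)
    (by
      rw [← MulOpposite.op_mul, ← MulOpposite.op_mul, ← MulOpposite.op_smul]
      congr 1
      rw [mul_neg, neg_mul, smul_neg, mul_assoc, ← mul_smul_comm, ← a_inv_mul_x])

/-- The inverse of the antipode: `a ↦ a⁻¹`, `x ↦ -x a⁻¹`. -/
def antipodeInvHom : TaftAlgebra F N q →ₐ[F] (TaftAlgebra F N q)ᵐᵒᵖ :=
  lift (MulOpposite.op (a F N q ^ (N - 1))) (MulOpposite.op (-(x F N q * a F N q ^ (N - 1))))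
    (by rw [← MulOpposite.op_pow, ← pow_mul, mul_comm, pow_mul, a_pow, one_pow]; rfl)
    (by
      obtain ⟨c, hc⟩ := exists_smul_pow (F := F) (N := N) (q := q) (N - 1) N
      rw [← MulOpposite.op_pow, neg_pow, qCommute_pow_right (x_mul_a F N q), smul_pow, hc, x_pow]
      simp)
    (by
      rw [← MulOpposite.op_mul, ← MulOpposite.op_mul, ← MulOpposite.op_smul]
      congr 1
      rw [mul_neg, neg_mul, smul_neg, ← mul_assoc, a_inv_mul_x, smul_mul_assoc])

instance : Bialgebra F (TaftAlgebra F N q) :=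
  Bialgebra.ofAlgHom (comulHom F N q) (counitHom F N q)
    (by
      apply algHom_ext
      · simp [comulHom]
      · simp [comulHom, TensorProduct.add_tmul, TensorProduct.tmul_add,
          Algebra.TensorProduct.one_def, add_assoc])
    (by
      apply algHom_ext
      · simp [comulHom, counitHom]
      · simp [comulHom, counitHom])
    (by
      apply algHom_ext
      · simp [comulHom, counitHom]
      · simp [comulHom, counitHom])

/-- The antipode as a linear map. -/
def antipodeLin : TaftAlgebra F N q →ₗ[F] TaftAlgebra F N q :=
  (MulOpposite.opLinearEquiv F).symm.toLinearMap ∘ₗ (antipodeHom F N q).toLinearMap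

lemma antipodeLin_mul (s t : TaftAlgebra F N q) :
    antipodeLin F N q (s * t) = antipodeLin F N q t * antipodeLin F N q s := by
  simp [antipodeLin]

lemma antipodeLin_one : antipodeLin F N q 1 = 1 := by simp [antipodeLin]
lemma antipodeLin_a : antipodeLin F N q (a F N q) = a F N q ^ (N - 1) := by
  simp [antipodeLin, antipodeHom]
lemma antipodeLin_x : antipodeLin F N q (x F N q) = -(a F N q ^ (N - 1) * x F N q) := by
  simp [antipodeLin, antipodeHom]

lemma comul_a : Coalgebra.comul (R := F) (a F N q) = a F N q ⊗ₜ a F N q :=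
  lift_a _ _ _ _ _
lemma comul_x : Coalgebra.comul (R := F) (x F N q) = x F N q ⊗ₜ 1 + a F N q ⊗ₜ x F N q :=
  lift_x _ _ _ _ _
lemma counit_a : Coalgebra.counit (R := F) (a F N q) = 1 := lift_a _ _ _ _ _
lemma counit_x : Coalgebra.counit (R := F) (x F N q) = 0 := lift_x _ _ _ _ _

lemma antipode_left (t : TaftAlgebra F N q) :
    LinearMap.mul' F _ ((antipodeLin F N q).rTensor _ (Coalgebra.comul t)) =
      algebraMap F _ (Coalgebra.counit t) := by
  induction t using induction with
  | halg r =>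
    simp [Algebra.TensorProduct.one_def, antipodeLin_one, Algebra.algebraMap_eq_smul_one]
  | ha => simp [comul_a, counit_a, antipodeLin_a, a_inv_mul_a]
  | hx => simp [comul_x, counit_x, antipodeLin_a, antipodeLin_x]
  | hadd s t hs ht => simp only [map_add, hs, ht]
  | hmul s t hs ht =>
    rw [Bialgebra.comul_mul, Bialgebra.counit_mul]
    have h : ∀ U W : TaftAlgebra F N q ⊗[F] TaftAlgebra F N q, ∀ r : F,
        LinearMap.mul' F _ ((antipodeLin F N q).rTensor _ U) = algebraMap F _ r →
        LinearMap.mul' F _ ((antipodeLin F N q).rTensor _ (U * W)) =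
          r • LinearMap.mul' F _ ((antipodeLin F N q).rTensor _ W) := by
      intro U W r hU
      induction W with
      | zero => simp
      | add u v hu hv => simp only [mul_add, map_add, hu, hv, smul_add]
      | tmul u v =>
        have : LinearMap.mul' F _ ((antipodeLin F N q).rTensor _ (U * (u ⊗ₜ v))) =
            antipodeLin F N q u * LinearMap.mul' F _ ((antipodeLin F N q).rTensor _ U) * v := by
          clear hU
          induction U with
          | zero => simp
          | add u v hu hv => simp only [mul_add, add_mul, map_add, hu, hv]
          | tmul u v => simp [antipodeLin_mul, mul_assoc]
        rw [this, hU]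
        simp [Algebra.algebraMap_eq_smul_one]
    rw [h _ _ _ hs, ht, map_mul, Algebra.smul_def]

lemma antipode_right (t : TaftAlgebra F N q) :
    LinearMap.mul' F _ ((antipodeLin F N q).lTensor _ (Coalgebra.comul t)) =
      algebraMap F _ (Coalgebra.counit t) := by
  induction t using induction with
  | halg r =>
    simp [Algebra.TensorProduct.one_def, antipodeLin_one, Algebra.algebraMap_eq_smul_one]
  | ha => simp [comul_a, counit_a, antipodeLin_a, a_mul_a_inv]
  | hx =>
    simp [comul_x, counit_x, antipodeLin_one, antipodeLin_x, ← mul_assoc, a_mul_a_inv]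
  | hadd s t hs ht => simp only [map_add, hs, ht]
  | hmul s t hs ht =>
    rw [Bialgebra.comul_mul, Bialgebra.counit_mul]
    have h : ∀ U W : TaftAlgebra F N q ⊗[F] TaftAlgebra F N q, ∀ r : F,
        LinearMap.mul' F _ ((antipodeLin F N q).lTensor _ W) = algebraMap F _ r →
        LinearMap.mul' F _ ((antipodeLin F N q).lTensor _ (U * W)) =
          r • LinearMap.mul' F _ ((antipodeLin F N q).lTensor _ U) := by
      intro U W r hW
      induction U with
      | zero => simp
      | add u v hu hv => simp only [add_mul, map_add, hu, hv, smul_add]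
      | tmul u v =>
        have : LinearMap.mul' F _ ((antipodeLin F N q).lTensor _ ((u ⊗ₜ v) * W)) =
            u * LinearMap.mul' F _ ((antipodeLin F N q).lTensor _ W) * antipodeLin F N q v := by
          clear hW
          induction W with
          | zero => simp
          | add u v hu hv => simp only [mul_add, add_mul, map_add, hu, hv]
          | tmul u v => simp [antipodeLin_mul, mul_assoc]
        rw [this, hW]
        simp [Algebra.algebraMap_eq_smul_one]
    rw [h _ _ _ ht, hs, mul_comm, map_mul, Algebra.smul_def]

instance : HopfAlgebra F (TaftAlgebra F N q) where
  antipode := antipodeLin F N q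
  mul_antipode_rTensor_comul := LinearMap.ext (antipode_left F N q)
  mul_antipode_lTensor_comul := LinearMap.ext (antipode_right F N q)

instance : HasBijectiveAntipode F (TaftAlgebra F N q) where
  bijective := by
    change Function.Bijective (antipodeLin F N q)
    have hpow : ∀ f : TaftAlgebra F N q →ₐ[F] (TaftAlgebra F N q)ᵐᵒᵖ,
        f (a F N q) = MulOpposite.op (a F N q ^ (N - 1)) →
        f (a F N q ^ (N - 1)) = MulOpposite.op (a F N q) := by
      intro f hf
      apply left_inv_eq_right_inv (a := f (a F N q))
      · rw [← map_mul, a_inv_mul_a, map_one]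
      · rw [hf, ← MulOpposite.op_mul, a_mul_a_inv, MulOpposite.op_one]
    have hSa := hpow (antipodeHom F N q) (lift_a _ _ _ _ _)
    have hSa' := hpow (antipodeInvHom F N q) (lift_a _ _ _ _ _)
    have h0 : ∀ t, antipodeLin F N q t = (antipodeHom F N q t).unop := fun _ => rfl
    refine Function.bijective_iff_has_inverse.2
      ⟨fun t => (antipodeInvHom F N q t).unop, fun t => ?_, fun t => ?_⟩
    · induction t using induction with
      | halg r => simp [h0]
      | ha => simp only [antipodeLin_a, hSa', MulOpposite.unop_op]
      | hx =>
        simp only [antipodeLin_x, map_neg, map_mul, hSa']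
        simp [antipodeInvHom, mul_assoc, a_inv_mul_a]
      | hmul s t hs ht => simp only [antipodeLin_mul, map_mul, MulOpposite.unop_mul, hs, ht]
      | hadd s t hs ht => simp only [map_add, MulOpposite.unop_add, hs, ht]
    · simp only [h0]
      induction t using induction with
      | halg r => simp
      | ha =>
        rw [antipodeInvHom, lift_a, MulOpposite.unop_op, hSa, MulOpposite.unop_op]
      | hx =>
        rw [antipodeInvHom, lift_x, MulOpposite.unop_op, map_neg, map_mul, hSa]
        simp [antipodeHom, ← mul_assoc, a_mul_a_inv]
      | hmul s t hs ht => simp only [map_mul, MulOpposite.unop_mul, hs, ht]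
      | hadd s t hs ht => simp only [map_add, MulOpposite.unop_add, hs, ht]

end TaftAlgebra

end Taft

section YangBaxter

variable {F : Type*} [Field F]

section Legs

variable (A : Type*) [Ring A] [Algebra F A]

/-- `R ↦ R₁₂`, i.e. `u ⊗ v ↦ u ⊗ v ⊗ 1`. -/
def leg₁₂ : A ⊗[F] A →ₐ[F] A ⊗[F] (A ⊗[F] A) :=
  Algebra.TensorProduct.map (AlgHom.id F A) Algebra.TensorProduct.includeLeft

/-- `R ↦ R₁₃`, i.e. `u ⊗ v ↦ u ⊗ 1 ⊗ v`. -/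
def leg₁₃ : A ⊗[F] A →ₐ[F] A ⊗[F] (A ⊗[F] A) :=
  Algebra.TensorProduct.map (AlgHom.id F A) Algebra.TensorProduct.includeRight

/-- `R ↦ R₂₃`, i.e. `u ⊗ v ↦ 1 ⊗ u ⊗ v`. -/
def leg₂₃ : A ⊗[F] A →ₐ[F] A ⊗[F] (A ⊗[F] A) :=
  Algebra.TensorProduct.includeRight

end Legs

/-- The multiplicative parametric Yang–Baxter equation
`R₁₂(μ) R₁₃(μν) R₂₃(ν) = R₂₃(ν) R₁₃(μν) R₁₂(μ)`. -/
def IsParametricYangBaxter {A : Type*} [Ring A] [Algebra F A] (R : F → A ⊗[F] A) : Prop :=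
  ∀ μ ν : F, leg₁₂ A (R μ) * leg₁₃ A (R (μ * ν)) * leg₂₃ A (R ν) =
    leg₂₃ A (R ν) * leg₁₃ A (R (μ * ν)) * leg₁₂ A (R μ)

end YangBaxter

namespace TaftAlgebra

/-- `Aᵖ = span {aⁱ xᵖ | 0 ≤ i < N}` for `0 ≤ p < N`, and `Aᵖ = 0` for all other integers `p`. -/
def grading (F : Type*) [Field F] (N : ℕ) (q : F) (p : ℤ) : Submodule F (TaftAlgebra F N q) :=
  Submodule.span F {t | ∃ i j : Fin N, ((j : ℕ) : ℤ) = p ∧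
    t = a F N q ^ (i : ℕ) * x F N q ^ (j : ℕ)}

/-- `R(μ) = ∑ μʲ eᵢⱼ ⊗ eᵢⱼ*` in `D(T) ⊗ D(T)`, for a basis `eᵢⱼ` of the Taft algebra `T` with dual
basis `eᵢⱼ*`. -/
def parametricR {F : Type*} [Field F] {N : ℕ} {q : F} [NeZero N] [Fact (IsPrimitiveRoot q N)]
    (e : Module.Basis (Fin N × Fin N) F (TaftAlgebra F N q)) (μ : F) :
    DrinfeldDouble F (TaftAlgebra F N q) ⊗[F] DrinfeldDouble F (TaftAlgebra F N q) :=
  ∑ i : Fin N, ∑ j : Fin N, μ ^ (j : ℕ) •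
    (DrinfeldDouble.ofHopf F _ (e (i, j)) ⊗ₜ[F]
      DrinfeldDouble.ofDual F _ (WithConv.toConv (e.coord (i, j))))

end TaftAlgebra

end

/-! The relations move every `a` to the left of every `x`, so the monomials `aⁱxʲ` with `i, j < N`
span. They are independent because `T` acts on functions `ℤ/N → F[X]/(Xᴺ)`, with `a` as the cyclic
shift and `x` as multiplication by `qⁱX` at position `i`: the monomial `aⁱxʲ` sends the delta
function at `0` to `Xʲ` placed at `i`. The pieces `Aᵖ` are then spanned by disjoint parts of a
basis. The coproduct respects degrees because it is an algebra map and `Δ(a)`, `Δ(x)` are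
homogeneous of degrees `0` and `1` in `T ⊗ T`.

The Yang–Baxter equation is the usual argument for the canonical element of a double, twisted by the
grading. The map `scale μ : a ↦ a, x ↦ μx` is a bialgebra endomorphism for every `μ`, including `0`,
it is multiplicative in `μ`, and `R(μ) = (scale μ ⊗ id)(R)` with `R = ∑ eᵢ ⊗ eᵢ*`. Put `σ = scale μ`
and `τ = scale ν`. Since convolution is dual to `Δ`, `R₁₃(μν) R₂₃(ν) = ∑ (στ ⊗ τ)Δ(eₗ) ⊗ eₗ*`, and
the opposite order gives the same sum with `Δᵒᵖ` (`sum_coord_mul_coord`). As `τ` respects `Δ`, `(στ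
⊗ τ)Δ = (σ ⊗ id)Δτ`, so `R₁₂(μ) = (σ ⊗ id)(R)` may be moved across once `R Δ(h) = Δᵒᵖ(h) R`
(`isYangBaxter_of_intertwines`). This intertwining need only be checked for `h = a` and `h = x`
(`halfR_intertwines`), where it follows from the cross relations of the double. -/

namespace TaftAlgebra

/-! ### Linear independence of the monomials through a concrete representation -/

section Representation

variable (F : Type*) [Field F] (N : ℕ) (q : F)

/-- The truncated polynomial ring `F[X] / (Xᴺ)`. -/
abbrev TruncatedPolynomial : Type _ := AdjoinRoot (Polynomial.X ^ N : Polynomial F)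

lemma truncatedPolynomial_root_pow :
    (AdjoinRoot.root (Polynomial.X ^ N : Polynomial F)) ^ N = 0 := by
  rw [← AdjoinRoot.mk_X, ← map_pow, AdjoinRoot.mk_self]

/-- A polynomial divisible by `Xᴺ` has no coefficients below degree `N`, and here those are the only
ones. -/
lemma truncatedPolynomial_coeff_eq_zero (c : Fin N → F)
    (h : ∑ j, c j • (AdjoinRoot.root (Polynomial.X ^ N : Polynomial F)) ^ (j : ℕ) = 0)
    (j : Fin N) : c j = 0 := by
  have h' : AdjoinRoot.mk (Polynomial.X ^ N : Polynomial F)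
      (∑ j : Fin N, c j • Polynomial.X ^ (j : ℕ)) = 0 := by
    rw [map_sum, ← h]
    refine Finset.sum_congr rfl fun k _ => ?_
    rw [← AdjoinRoot.smul_mk, map_pow, AdjoinRoot.mk_X]
  rw [AdjoinRoot.mk_eq_zero, Polynomial.X_pow_dvd_iff] at h'
  have := h' j j.2
  simpa [Polynomial.coeff_X_pow, Fin.val_inj] using this

/-- The cyclic shift on functions `ℤ/N → F[X] / (Xᴺ)`. -/
noncomputable def shiftEnd : Module.End F (ZMod N → TruncatedPolynomial F N) where
  toFun f i := f (i - 1)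
  map_add' _ _ := rfl
  map_smul' _ _ := rfl

/-- Multiplication by `qⁱ X` at `i`, on functions `ℤ/N → F[X] / (Xᴺ)`. -/
noncomputable def clockEnd : Module.End F (ZMod N → TruncatedPolynomial F N) where
  toFun f i := q ^ i.val • (AdjoinRoot.root (Polynomial.X ^ N : Polynomial F) * f i)
  map_add' f g := by ext i; simp [mul_add]
  map_smul' r f := by ext i; simp [smul_comm r]

lemma shiftEnd_pow_apply (n : ℕ) (f : ZMod N → TruncatedPolynomial F N) (i : ZMod N) :
    (shiftEnd F N ^ n) f i = f (i - n) := by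
  induction n generalizing i with
  | zero => simp
  | succ n ih =>
    rw [pow_succ', Module.End.mul_apply]
    change (shiftEnd F N ^ n) f (i - 1) = _
    rw [ih]; push_cast; congr 1; ring

lemma clockEnd_pow_apply (n : ℕ) (f : ZMod N → TruncatedPolynomial F N) (i : ZMod N) :
    (clockEnd F N q ^ n) f i =
      q ^ (i.val * n) • (AdjoinRoot.root (Polynomial.X ^ N : Polynomial F) ^ n * f i) := by
  induction n with
  | zero => simp
  | succ n ih =>
    rw [pow_succ', Module.End.mul_apply]
    change q ^ i.val • (_ * (clockEnd F N q ^ n) f i) = _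
    rw [ih, mul_smul_comm, smul_smul, ← mul_assoc, ← pow_succ', ← pow_add, Nat.mul_succ, add_comm]

variable [NeZero N] [hq : Fact (IsPrimitiveRoot q N)]

/-- Away from `i = 0` this only lowers the exponent by one; at the wrap-around it needs `qᴺ = 1`. It
is the relation `xa = q ax` for the shift and clock operators. -/
lemma pow_val_sub_one (i : ZMod N) : q ^ i.val = q * q ^ (i - 1).val := by
  have h : i.val = ((i - 1).val + 1) % N := by
    rw [← ZMod.val_natCast]; simp
  rw [h, ← pow_eq_pow_mod _ hq.out.pow_eq_one, pow_succ']

/-- A representation of the Taft algebra on functions `ℤ/N → F[X] / (Xᴺ)`. -/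
noncomputable def regularRep :
    TaftAlgebra F N q →ₐ[F] Module.End F (ZMod N → TruncatedPolynomial F N) :=
  lift (shiftEnd F N) (clockEnd F N q)
    (by refine LinearMap.ext fun f => funext fun i => ?_; simp [shiftEnd_pow_apply])
    (by
      refine LinearMap.ext fun f => funext fun i => ?_
      rw [clockEnd_pow_apply, truncatedPolynomial_root_pow]; simp)
    (by
      refine LinearMap.ext fun f => funext fun i => ?_
      change q ^ i.val • (_ * f (i - 1)) = q • (q ^ (i - 1).val • (_ * f (i - 1)))
      rw [smul_smul, ← pow_val_sub_one])

/-- No power of `q` appears because `x` acts first, at position `0`, where its scalar is `q⁰`; then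
`aⁱ` carries the result to position `i`. -/
lemma regularRep_monomial (i j : ℕ) (k : ZMod N) :
    regularRep F N q (a F N q ^ i * x F N q ^ j) (Pi.single 0 1) k =
      if k = i then AdjoinRoot.root (Polynomial.X ^ N : Polynomial F) ^ j else 0 := by
  rw [regularRep, map_mul, map_pow, map_pow, lift_a, lift_x, Module.End.mul_apply,
    shiftEnd_pow_apply, clockEnd_pow_apply]
  by_cases h : k = i
  · subst h; simp
  · simp [h, sub_eq_zero]

lemma linearIndependent_monomial :
    LinearIndependent F (fun ij : Fin N × Fin N =>
      a F N q ^ (ij.1 : ℕ) * x F N q ^ (ij.2 : ℕ)) := by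
  rw [Fintype.linearIndependent_iff]
  rintro c h ⟨k, l⟩
  apply truncatedPolynomial_coeff_eq_zero F N (fun l => c (k, l))
  -- Applying the relation to the delta function at `0` and reading position `k` keeps only the
  -- terms with first index `k`.
  have := congrFun (LinearMap.congr_fun (congrArg (regularRep F N q) h) (Pi.single 0 1)) (k : ℕ)
  simp only [map_sum, map_smul, LinearMap.sum_apply, LinearMap.smul_apply, Finset.sum_apply,
    Pi.smul_apply, regularRep_monomial, map_zero, LinearMap.zero_apply, Pi.zero_apply,
    Fintype.sum_prod_type] at this
  rw [Finset.sum_eq_single k _ (by simp)] at this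
  · simpa using this
  · intro i _ hi
    refine Finset.sum_eq_zero fun j _ => ?_
    rw [if_neg, smul_zero]
    intro he
    apply hi
    rw [ZMod.natCast_eq_natCast_iff', Nat.mod_eq_of_lt k.2, Nat.mod_eq_of_lt i.2] at he
    exact (Fin.ext he).symm

end Representation

/-! ### The grading, the monomial basis and the homogeneity of the coproduct -/

section Grading

variable (F : Type*) [Field F] (N : ℕ) (q : F) [NeZero N]

/-- The exponents are unrestricted so that products of monomials are covered: `n` is reduced modulo
`N` by `aᴺ = 1`, and `xᵐ = 0` once `m ≥ N`. -/
lemma monomial_mem_grading (n m : ℕ) :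
    a F N q ^ n * x F N q ^ m ∈ grading F N q m := by
  by_cases hm : m < N
  · refine Submodule.subset_span ⟨⟨n % N, Nat.mod_lt _ (NeZero.pos N)⟩, ⟨m, hm⟩, rfl, ?_⟩
    simp only
    conv_lhs => rw [← Nat.mod_add_div n N, pow_add, pow_mul, a_pow, one_pow, mul_one]
  · rw [show m = N + (m - N) by omega, pow_add, x_pow, zero_mul, mul_zero]
    exact zero_mem _

omit [NeZero N] in
lemma monomial_mul_monomial (i j k l : ℕ) :
    a F N q ^ i * x F N q ^ j * (a F N q ^ k * x F N q ^ l) =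
      (q ^ j) ^ k • (a F N q ^ (i + k) * x F N q ^ (j + l)) := by
  rw [mul_assoc, ← mul_assoc (x F N q ^ j),
    qCommute_pow_right (qCommute_pow (x_mul_a F N q) j) k]
  simp only [smul_mul_assoc, mul_smul_comm, pow_add, mul_assoc]

instance grading_gradedMonoid : SetLike.GradedMonoid (grading F N q) where
  one_mem := by simpa using monomial_mem_grading F N q 0 0
  mul_mem p r s t hs ht := by
    refine Submodule.span_induction₂ (p := fun u v _ _ => u * v ∈ grading F N q (p + r))
      ?_ (by simp) (by simp) ?_ ?_ ?_ ?_ hs ht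
    · rintro _ _ ⟨i, j, rfl, rfl⟩ ⟨k, l, rfl, rfl⟩
      rw [monomial_mul_monomial]
      exact Submodule.smul_mem _ _ (by exact_mod_cast monomial_mem_grading F N q _ _)
    · intro u v w _ _ _ h₁ h₂; rw [add_mul]; exact add_mem h₁ h₂
    · intro u v w _ _ _ h₁ h₂; rw [mul_add]; exact add_mem h₁ h₂
    · intro c u v _ _ h; rw [smul_mul_assoc]; exact Submodule.smul_mem _ _ h
    · intro c u v _ _ h; rw [mul_smul_comm]; exact Submodule.smul_mem _ _ h

/-- The sum of the graded pieces is closed under multiplication and contains the scalars and both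
generators. -/
lemma iSup_grading : ⨆ p, grading F N q p = ⊤ := by
  have hle : ∀ p, grading F N q p ≤ ⨆ p, grading F N q p := le_iSup _
  refine eq_top_iff.2 fun t _ => ?_
  induction t using induction with
  | halg r =>
    rw [Algebra.algebraMap_eq_smul_one]
    exact Submodule.smul_mem _ _ (hle 0 SetLike.GradedOne.one_mem)
  | ha => exact hle 0 (by simpa using monomial_mem_grading F N q 1 0)
  | hx => exact hle 1 (by simpa using monomial_mem_grading F N q 0 1)
  | hadd s t hs ht => exact add_mem (hs trivial) (ht trivial)
  | hmul s t hs ht =>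
    have := Submodule.mul_mem_mul (hs trivial) (ht trivial)
    rw [Submodule.iSup_mul] at this
    simp only [Submodule.mul_iSup] at this
    refine (show _ ≤ ⨆ p, grading F N q p from iSup_le fun p => iSup_le fun r => ?_) this
    refine le_trans (Submodule.mul_le.2 fun u hu v hv => ?_) (hle (r + p))
    exact add_comm p r ▸ SetLike.GradedMul.mul_mem hu hv

lemma span_monomial : ⊤ ≤ Submodule.span F (Set.range fun ij : Fin N × Fin N =>
    a F N q ^ (ij.1 : ℕ) * x F N q ^ (ij.2 : ℕ)) := by
  rw [← iSup_grading]
  refine iSup_le fun p => Submodule.span_mono ?_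
  rintro _ ⟨i, j, -, rfl⟩
  exact ⟨(i, j), rfl⟩

/-- The basis `aⁱ xʲ`, `0 ≤ i, j < N`, of the Taft algebra. -/
noncomputable def monomialBasis [Fact (IsPrimitiveRoot q N)] :
    Module.Basis (Fin N × Fin N) F (TaftAlgebra F N q) :=
  Module.Basis.mk (linearIndependent_monomial F N q) (span_monomial F N q)

lemma monomialBasis_apply [Fact (IsPrimitiveRoot q N)] (i j : Fin N) :
    monomialBasis F N q (i, j) = a F N q ^ (i : ℕ) * x F N q ^ (j : ℕ) := by
  rw [monomialBasis, Module.Basis.mk_apply]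

omit [NeZero N] in
lemma grading_eq_span_image (p : ℤ) : grading F N q p = Submodule.span F
    ((fun ij : Fin N × Fin N => a F N q ^ (ij.1 : ℕ) * x F N q ^ (ij.2 : ℕ)) ''
      {ij | ((ij.2 : ℕ) : ℤ) = p}) := by
  rw [grading]
  congr 1
  ext t
  constructor
  · rintro ⟨i, j, h, rfl⟩; exact ⟨(i, j), h, rfl⟩
  · rintro ⟨⟨i, j⟩, h, rfl⟩; exact ⟨i, j, h, rfl⟩

/-- Spans of disjoint subfamilies of an independent family are disjoint: degree `p` is compared with
the span of all monomials of other degrees. -/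
lemma isInternal_grading [Fact (IsPrimitiveRoot q N)] :
    DirectSum.IsInternal (grading F N q) := by
  refine DirectSum.isInternal_submodule_of_iSupIndep_of_iSup_eq_top (fun p => ?_)
    (iSup_grading F N q)
  have hle : ⨆ r, ⨆ _ : r ≠ p, grading F N q r ≤ Submodule.span F
      ((fun ij : Fin N × Fin N => a F N q ^ (ij.1 : ℕ) * x F N q ^ (ij.2 : ℕ)) ''
        {ij | ((ij.2 : ℕ) : ℤ) ≠ p}) := by
    refine iSup₂_le fun r hr => ?_
    rw [grading_eq_span_image]
    exact Submodule.span_mono (Set.image_mono fun ij h => (show _ = _ from h).trans_ne hr)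
  rw [grading_eq_span_image]
  refine Disjoint.mono_right hle ?_
  refine (linearIndependent_monomial F N q).disjoint_span_image ?_
  exact Set.disjoint_left.2 fun ij h h' => h' h

lemma grading_one_ne_bot [Fact (IsPrimitiveRoot q N)] (hN : 2 ≤ N) : grading F N q 1 ≠ ⊥ := by
  intro h
  have hx : a F N q ^ 0 * x F N q ^ 1 ∈ grading F N q 1 := monomial_mem_grading F N q 0 1
  rw [h, Submodule.mem_bot] at hx
  exact (linearIndependent_monomial F N q).ne_zero (⟨0, by omega⟩, ⟨1, by omega⟩) hx

/-- The component `∑ᵣ Aʳ ⊗ Aᵖ⁻ʳ` of `T ⊗ T`. -/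
def tensorGrading (p : ℤ) : Submodule F (TaftAlgebra F N q ⊗[F] TaftAlgebra F N q) :=
  ⨆ r : ℤ, LinearMap.range
    (TensorProduct.map (grading F N q r).subtype (grading F N q (p - r)).subtype)

omit [NeZero N] in
lemma tmul_mem_tensorGrading {p r s : ℤ} (h : r + s = p) {u v : TaftAlgebra F N q}
    (hu : u ∈ grading F N q r) (hv : v ∈ grading F N q s) :
    u ⊗ₜ[F] v ∈ tensorGrading F N q p := by
  obtain rfl : s = p - r := by omega
  exact Submodule.mem_iSup_of_mem r ⟨⟨u, hu⟩ ⊗ₜ ⟨v, hv⟩, rfl⟩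

/-- Multiplicativity of the total degree on `T ⊗ T` reduces the homogeneity of `Δ` on monomials to
that of `Δ(a)` and `Δ(x)`. -/
instance tensorGrading_gradedMonoid : SetLike.GradedMonoid (tensorGrading F N q) where
  one_mem := tmul_mem_tensorGrading F N q (add_zero 0) SetLike.GradedOne.one_mem
    SetLike.GradedOne.one_mem
  mul_mem p s U V hU hV := by
    have := Submodule.mul_mem_mul hU hV
    rw [tensorGrading, tensorGrading, Submodule.iSup_mul] at this
    simp only [Submodule.mul_iSup] at this
    refine (show _ ≤ tensorGrading F N q (p + s) from iSup_le fun r' => iSup_le fun r => ?_) this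
    rw [TensorProduct.range_map_eq_span_tmul, TensorProduct.range_map_eq_span_tmul,
      Submodule.span_mul_span, Submodule.span_le]
    rintro _ ⟨_, ⟨u, v, rfl⟩, _, ⟨u', v', rfl⟩, rfl⟩
    simp only [Algebra.TensorProduct.tmul_mul_tmul]
    exact tmul_mem_tensorGrading F N q (by ring) (SetLike.GradedMul.mul_mem u.2 u'.2)
      (SetLike.GradedMul.mul_mem v.2 v'.2)

lemma comul_mem_tensorGrading [Fact (IsPrimitiveRoot q N)] {p : ℤ} {t : TaftAlgebra F N q}
    (ht : t ∈ grading F N q p) : Coalgebra.comul (R := F) t ∈ tensorGrading F N q p := by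
  refine (Submodule.span_le (p := (tensorGrading F N q p).comap Coalgebra.comul)).2 ?_ ht
  rintro _ ⟨i, j, rfl, rfl⟩
  have ha : a F N q ∈ grading F N q 0 := by simpa using monomial_mem_grading F N q 1 0
  have hx : x F N q ∈ grading F N q 1 := by simpa using monomial_mem_grading F N q 0 1
  have h1 : (1 : TaftAlgebra F N q) ∈ grading F N q 0 := SetLike.GradedOne.one_mem
  rw [SetLike.mem_coe, Submodule.mem_comap, Bialgebra.comul_mul, Bialgebra.comul_pow,
    Bialgebra.comul_pow, comul_a, comul_x]
  have hA := SetLike.pow_mem_graded (i : ℕ) (tmul_mem_tensorGrading F N q (add_zero 0) ha ha)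
  have hX := SetLike.pow_mem_graded (j : ℕ) (add_mem
    (tmul_mem_tensorGrading F N q (add_zero 1) hx h1)
    (tmul_mem_tensorGrading F N q (zero_add 1) ha hx))
  simpa using SetLike.GradedMul.mul_mem hA hX

end Grading

end TaftAlgebra

/-! ### Identities for a basis and its dual basis -/

section DualBasis

variable {F H ι : Type*} [Field F] [Ring H] [HopfAlgebra F H] [Fintype ι]

/-- Under `H ⊗ H* ≅ End H` both canonical sums represent `φ`: the transpose of `φ` on the dual leg
is `φ` on the first leg. This is how conjugated functionals are removed from the dual leg later. -/
lemma sum_tmul_coord_comp {M P : Type*} [AddCommGroup M] [Module F M] [AddCommGroup P]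
    [Module F P] (e : Module.Basis ι F H) (φ : H →ₗ[F] H) (χ : H →ₗ[F] P)
    (ψ : ConvDual F H →ₗ[F] M) :
    ∑ i, χ (e i) ⊗ₜ[F] ψ (WithConv.toConv (e.coord i ∘ₗ φ)) =
      ∑ i, χ (φ (e i)) ⊗ₜ[F] ψ (WithConv.toConv (e.coord i)) := by
  classical
  have h1 : ∀ i, WithConv.toConv (e.coord i ∘ₗ φ) =
      ∑ k, e.coord i (φ (e k)) • WithConv.toConv (e.coord k) := by
    intro i
    apply WithConv.ext
    refine e.ext fun l => ?_
    rw [WithConv.ofConv_sum]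
    simp [LinearMap.sum_apply, Finsupp.single_apply]
  simp only [h1, map_sum, map_smul, TensorProduct.tmul_sum, TensorProduct.tmul_smul,
    TensorProduct.smul_tmul']
  rw [Finset.sum_comm]
  refine Finset.sum_congr rfl fun k _ => ?_
  rw [← TensorProduct.sum_tmul]
  congr 1
  conv_rhs => rw [← e.sum_repr (φ (e k)), map_sum]
  exact Finset.sum_congr rfl fun i _ => (map_smul χ _ _).symm

/-- The coefficient of `eₗ*` in `eⱼ* eₖ*` is the coefficient of `eⱼ ⊗ eₖ` in `Δ(eₗ)`, by the
definition of convolution. -/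
lemma sum_coord_mul_coord {M P : Type*} [AddCommGroup M] [Module F M]
    [AddCommGroup P] [Module F P]
    (e : Module.Basis ι F H) (Φ : H ⊗[F] H →ₗ[F] M) (ψ : ConvDual F H →ₗ[F] P) :
    ∑ j, ∑ k, Φ (e j ⊗ₜ[F] e k) ⊗ₜ[F]
        ψ (WithConv.toConv (e.coord j) * WithConv.toConv (e.coord k)) =
      ∑ l, Φ (Coalgebra.comul (e l)) ⊗ₜ[F] ψ (WithConv.toConv (e.coord l)) := by
  classical
  have h1 : ∀ j k, (WithConv.toConv (e.coord j) * WithConv.toConv (e.coord k) : ConvDual F H) =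
      ∑ l, (e.tensorProduct e).repr (Coalgebra.comul (e l)) (j, k) •
        WithConv.toConv (e.coord l) := by
    intro j k
    apply WithConv.ext
    refine e.ext fun l => ?_
    have h2 : ∀ w : H ⊗[F] H, LinearMap.mul' F F (TensorProduct.map (e.coord j) (e.coord k) w) =
        (e.tensorProduct e).repr w (j, k) := by
      intro w
      induction w with
      | zero => simp
      | add u v hu hv => simp [hu, hv]
      | tmul u v => simp [mul_comm]
    rw [WithConv.ofConv_sum]
    simp only [LinearMap.sum_apply]
    refine (h2 _).trans ?_
    simp [Finsupp.single_apply]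
  simp only [h1, map_sum, map_smul, TensorProduct.tmul_sum, TensorProduct.tmul_smul,
    TensorProduct.smul_tmul']
  simp only [← Fintype.sum_prod_type' (f := fun j k => ∑ l, _)]
  rw [Finset.sum_comm]
  refine Finset.sum_congr rfl fun l _ => ?_
  rw [← TensorProduct.sum_tmul]
  congr 1
  conv_rhs => rw [← (e.tensorProduct e).sum_repr (Coalgebra.comul (e l))]
  rw [map_sum]
  exact Finset.sum_congr rfl fun jk _ => by
    rw [map_smul, Module.Basis.tensorProduct_apply]

end DualBasis

namespace DrinfeldDouble

lemma ofDual_mul_ofHopf {F H : Type*} [Field F] [Ring H] [HopfAlgebra F H]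
    [HasBijectiveAntipode F H] (f : ConvDual F H) (h : H) :
    ofDual F H f * ofHopf F H h = tmul f h := by
  rw [ofHopf_apply, ofDual_apply, mul_def]
  change doubleMul F H (f ⊗ₜ 1) (1 ⊗ₜ h) = f ⊗ₜ h
  rw [doubleMul_tmul, map_one, Module.End.one_apply, dualMulLeft_tmul, mul_one]

end DrinfeldDouble

/-! ### From the intertwining relation to the Yang–Baxter equation -/

section YangBaxterDouble

variable {F H D ι : Type*} [Field F] [Ring H] [HopfAlgebra F H] [Ring D] [Algebra F D]
  [Fintype ι] (e : Module.Basis ι F H) (κ : H →ₐ[F] D) (ψ : ConvDual F H →ₐ[F] D)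

/-- The element `∑ eᵢ ⊗ ψ(eᵢ*)` of `H ⊗ D`. -/
noncomputable def halfR : H ⊗[F] D :=
  ∑ i, e i ⊗ₜ[F] ψ (WithConv.toConv (e.coord i))

/-- The coproduct followed by `κ` on the second factor. -/
noncomputable def halfComul : H →ₐ[F] H ⊗[F] D :=
  (Algebra.TensorProduct.map (AlgHom.id F H) κ).comp (Bialgebra.comulAlgHom F H)

/-- The opposite coproduct followed by `κ` on the second factor. -/
noncomputable def halfComulOp : H →ₐ[F] H ⊗[F] D :=
  (Algebra.TensorProduct.map (AlgHom.id F H) κ).comp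
    ((Algebra.TensorProduct.comm F H H).toAlgHom.comp (Bialgebra.comulAlgHom F H))

/-- If `∑ eᵢ ⊗ eᵢ*` intertwines the coproduct and its opposite, then
`R(ρ) = ∑ ρ(eᵢ) ⊗ eᵢ*` satisfies `R₁₂(σ) R₁₃(στ) R₂₃(τ) = R₂₃(τ) R₁₃(στ) R₁₂(σ)`, for algebra
endomorphisms `σ` and `τ` such that `τ` respects the coproduct. -/
lemma isYangBaxter_of_intertwines (σ τ : H →ₐ[F] H)
    (hτ : TensorProduct.map τ.toLinearMap τ.toLinearMap ∘ₗ Coalgebra.comul =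
      Coalgebra.comul ∘ₗ τ.toLinearMap)
    (hR : ∀ h, halfR e ψ * halfComul κ h = halfComulOp κ h * halfR e ψ)
    (R : (H →ₐ[F] H) → D ⊗[F] D)
    (hRdef : ∀ ρ, R ρ = ∑ i, κ (ρ (e i)) ⊗ₜ[F] ψ (WithConv.toConv (e.coord i))) :
    leg₁₂ D (R σ) * leg₁₃ D (R (σ.comp τ)) * leg₂₃ D (R τ) =
      leg₂₃ D (R τ) * leg₁₃ D (R (σ.comp τ)) * leg₁₂ D (R σ) := by
  -- `σ` and `τ` act on `H` and not on `D`, so the intertwining relation lives in `H ⊗ D`; `Θ`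
  -- twists its first leg by `σ` and embeds it in `D`.
  let Φ : H ⊗[F] H →ₐ[F] D ⊗[F] D := Algebra.TensorProduct.map (κ.comp (σ.comp τ)) (κ.comp τ)
  let Θ : H ⊗[F] D →ₐ[F] D ⊗[F] D := Algebra.TensorProduct.map (κ.comp σ) (AlgHom.id F D)
  have hhalf : Θ (halfR e ψ) = R σ := by
    simp [Θ, halfR, hRdef]
  -- Compatibility of `τ` with the coproduct turns `(στ ⊗ τ)Δ(h)` into `(σ ⊗ id)Δ(τ h)`; `hopp` is
  -- the same for the flipped coproduct.
  have hcomul : ∀ h, Φ (Coalgebra.comul h) = Θ (halfComul κ (τ h)) := by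
    intro h
    have : Φ.toLinearMap = (Θ.toLinearMap ∘ₗ
        (Algebra.TensorProduct.map (AlgHom.id F H) κ).toLinearMap) ∘ₗ
        TensorProduct.map τ.toLinearMap τ.toLinearMap := by
      ext u v; simp [Φ, Θ]
    have h2 := LinearMap.congr_fun this (Coalgebra.comul h)
    have h3 := LinearMap.congr_fun hτ h
    simp only [LinearMap.comp_apply] at h2 h3
    rw [h3] at h2
    exact h2
  have hopp : ∀ h, Φ (TensorProduct.comm F H H (Coalgebra.comul h)) = Θ (halfComulOp κ (τ h)) := by
    intro h
    have : Φ.toLinearMap ∘ₗ (TensorProduct.comm F H H).toLinearMap =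
        (Θ.toLinearMap ∘ₗ (Algebra.TensorProduct.map (AlgHom.id F H) κ).toLinearMap ∘ₗ
          (TensorProduct.comm F H H).toLinearMap) ∘ₗ
        TensorProduct.map τ.toLinearMap τ.toLinearMap := by
      ext u v; simp [Φ, Θ]
    have h2 := LinearMap.congr_fun this (Coalgebra.comul h)
    have h3 := LinearMap.congr_fun hτ h
    simp only [LinearMap.comp_apply] at h2 h3
    rw [h3] at h2
    exact h2
  have hcomm : ∀ h, R σ * Φ (Coalgebra.comul h) =
      Φ (TensorProduct.comm F H H (Coalgebra.comul h)) * R σ := by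
    intro h
    rw [hcomul, hopp, ← hhalf, ← map_mul, hR, map_mul]
  let α : (D ⊗[F] D) ⊗[F] D →ₐ[F] D ⊗[F] (D ⊗[F] D) :=
    (Algebra.TensorProduct.assoc F F F D D D).toAlgHom
  have h12 : ∀ u : D ⊗[F] D, leg₁₂ D u = α (u ⊗ₜ 1) := by
    intro u
    induction u with
    | zero => simp
    | add u v hu hv => simp only [map_add, TensorProduct.add_tmul, hu, hv]
    | tmul u v => simp [leg₁₂, α]
  have hL : leg₁₃ D (R (σ.comp τ)) * leg₂₃ D (R τ) =
      α (∑ l, Φ (Coalgebra.comul (e l)) ⊗ₜ[F] ψ (WithConv.toConv (e.coord l))) := by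
    have := sum_coord_mul_coord e Φ.toLinearMap ψ.toLinearMap
    simp only [AlgHom.toLinearMap_apply] at this
    rw [← this]
    simp only [hRdef, map_sum, Finset.sum_mul_sum]
    refine Finset.sum_congr rfl fun j _ => Finset.sum_congr rfl fun k _ => ?_
    simp [leg₁₃, leg₂₃, α, Φ]
  -- In this order the first dual factor is paired with the second leg, hence the flip before `Φ`.
  have hRr : leg₂₃ D (R τ) * leg₁₃ D (R (σ.comp τ)) =
      α (∑ l, Φ (TensorProduct.comm F H H (Coalgebra.comul (e l))) ⊗ₜ[F]
        ψ (WithConv.toConv (e.coord l))) := by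
    have := sum_coord_mul_coord e (Φ.toLinearMap ∘ₗ (TensorProduct.comm F H H).toLinearMap)
      ψ.toLinearMap
    simp only [LinearMap.comp_apply, AlgHom.toLinearMap_apply, LinearEquiv.coe_coe] at this
    rw [← this]
    simp only [hRdef, map_sum, Finset.sum_mul_sum]
    refine Finset.sum_congr rfl fun j _ => Finset.sum_congr rfl fun k _ => ?_
    simp [leg₁₃, leg₂₃, α, Φ]
  -- `R₁₂` is trivial on the third leg, so `hcomm` applies to each summand separately.
  rw [mul_assoc, hL, hRr, h12, ← map_mul, ← map_mul]
  refine congrArg α ((Finset.mul_sum _ _ _).trans (.trans ?_ (Finset.sum_mul _ _ _).symm))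
  refine Finset.sum_congr rfl fun l _ => ?_
  rw [Algebra.TensorProduct.tmul_mul_tmul, Algebra.TensorProduct.tmul_mul_tmul, hcomm, one_mul,
    mul_one]

end YangBaxterDouble

/-! ### Cross relations in the double and the intertwining property -/

namespace TaftAlgebra

section

variable (F : Type*) [Field F] (N : ℕ) (q : F) [NeZero N] [hq : Fact (IsPrimitiveRoot q N)]

lemma antipodeInv_a : antipodeInv F (TaftAlgebra F N q) (a F N q) = a F N q ^ (N - 1) := by
  apply (HasBijectiveAntipode.bijective (F := F) (H := TaftAlgebra F N q)).1
  rw [antipode_antipodeInv]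
  change _ = antipodeLin F N q _
  change _ = (antipodeHom F N q _).unop
  rw [map_pow, antipodeHom, lift_a, ← MulOpposite.op_pow, MulOpposite.unop_op, ← pow_mul]
  obtain ⟨n, rfl⟩ := Nat.exists_eq_succ_of_ne_zero (NeZero.ne N)
  -- With `N = n + 1` this is `(N - 1)² = N(N - 2) + 1`, so `a^((N-1)²) = a`. At `n = 0` the
  -- truncated `n - 1` makes the identity false, but then `a = 1`.
  have : (n.succ - 1) * (n.succ - 1) = n.succ * (n - 1) + 1 ∨ n = 0 := by
    rcases n with _ | n
    · exact Or.inr rfl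
    · left; simp; ring
  rcases this with h | rfl
  · rw [h, pow_succ, pow_mul, a_pow, one_pow, one_mul]
  · simpa using a_pow F 1 q

lemma antipodeInv_x :
    antipodeInv F (TaftAlgebra F N q) (x F N q) = -(x F N q * a F N q ^ (N - 1)) := by
  apply (HasBijectiveAntipode.bijective (F := F) (H := TaftAlgebra F N q)).1
  rw [antipode_antipodeInv, map_neg, HopfAlgebra.antipode_mul_antidistrib, ← antipodeInv_a,
    antipode_antipodeInv]
  change _ = -(_ * antipodeLin F N q _)
  rw [antipodeLin_x, mul_neg, neg_neg, ← mul_assoc, a_mul_a_inv, one_mul]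

variable {F N q} {ι : Type*} [Fintype ι] (e : Module.Basis ι F (TaftAlgebra F N q))

lemma ofHopf_a_mul_ofDual (f : ConvDual F (TaftAlgebra F N q)) :
    DrinfeldDouble.ofHopf F _ (a F N q) * DrinfeldDouble.ofDual F _ f =
      DrinfeldDouble.ofDual F _ (conjFunctional F _ (a F N q) (a F N q) f) *
        DrinfeldDouble.ofHopf F _ (a F N q) := by
  have h := DrinfeldDouble.tmul_mul_tmul (F := F) (Finset.univ : Finset (Fin 1))
    (fun _ => a F N q) (fun _ => a F N q) (fun _ => a F N q) 1 f (a F N q) 1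
    (by simp [comul₃, comul_a])
  rw [DrinfeldDouble.ofDual_mul_ofHopf, DrinfeldDouble.ofHopf_apply,
    DrinfeldDouble.ofDual_apply, h]
  simp

lemma ofHopf_x_mul_ofDual (f : ConvDual F (TaftAlgebra F N q)) :
    DrinfeldDouble.ofHopf F _ (x F N q) * DrinfeldDouble.ofDual F _ f =
      DrinfeldDouble.ofDual F _ (conjFunctional F _ (x F N q) 1 f) +
      DrinfeldDouble.ofDual F _ (conjFunctional F _ (a F N q) 1 f) *
        DrinfeldDouble.ofHopf F _ (x F N q) +
      DrinfeldDouble.ofDual F _ (conjFunctional F _ (a F N q) (x F N q) f) *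
        DrinfeldDouble.ofHopf F _ (a F N q) := by
  -- The columns of the three vectors are the terms of `x ⊗ 1 ⊗ 1 + a ⊗ x ⊗ 1 + a ⊗ a ⊗ x`, the
  -- iterated coproduct of `x`.
  have h := DrinfeldDouble.tmul_mul_tmul (F := F) (Finset.univ : Finset (Fin 3))
    ![x F N q, a F N q, a F N q] ![1, x F N q, a F N q] ![1, 1, x F N q] 1 f (x F N q) 1
    (by simp [comul₃, comul_x, Fin.sum_univ_three, TensorProduct.tmul_add,
      Algebra.TensorProduct.one_def, add_assoc])
  rw [DrinfeldDouble.ofDual_mul_ofHopf, DrinfeldDouble.ofDual_mul_ofHopf,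
    DrinfeldDouble.ofHopf_apply, DrinfeldDouble.ofDual_apply, DrinfeldDouble.ofDual_apply, h]
  simp [Fin.sum_univ_three]

lemma halfComul_a : halfComul (DrinfeldDouble.ofHopf F _) (a F N q) =
    a F N q ⊗ₜ DrinfeldDouble.ofHopf F _ (a F N q) := by
  simp [halfComul, comul_a]

lemma halfComulOp_a : halfComulOp (DrinfeldDouble.ofHopf F _) (a F N q) =
    a F N q ⊗ₜ DrinfeldDouble.ofHopf F _ (a F N q) := by
  simp [halfComulOp, comul_a]

lemma halfComul_x : halfComul (DrinfeldDouble.ofHopf F _) (x F N q) =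
    x F N q ⊗ₜ 1 + a F N q ⊗ₜ DrinfeldDouble.ofHopf F _ (x F N q) := by
  simp [halfComul, comul_x]

lemma halfComulOp_x : halfComulOp (DrinfeldDouble.ofHopf F _) (x F N q) =
    1 ⊗ₜ DrinfeldDouble.ofHopf F _ (x F N q) +
      x F N q ⊗ₜ DrinfeldDouble.ofHopf F _ (a F N q) := by
  simp [halfComulOp, comul_x]

/-- Conjugation on the dual leg is the transpose of `y ↦ S⁻¹(d) y c`, so it can be carried out on
the first leg. -/
lemma sum_tmul_conjFunctional (s c d : TaftAlgebra F N q)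
    (u : DrinfeldDouble F (TaftAlgebra F N q)) :
    ∑ i, (s * e i) ⊗ₜ[F] (DrinfeldDouble.ofDual F _
        (conjFunctional F _ c d (WithConv.toConv (e.coord i))) * u) =
      ∑ i, (s * (antipodeInv F _ d * (e i * c))) ⊗ₜ[F]
        (DrinfeldDouble.ofDual F _ (WithConv.toConv (e.coord i)) * u) :=
  sum_tmul_coord_comp e (LinearMap.mulLeft F (antipodeInv F _ d) ∘ₗ LinearMap.mulRight F c)
    (LinearMap.mulLeft F s)
    (LinearMap.mulRight F u ∘ₗ (DrinfeldDouble.ofDual F (TaftAlgebra F N q)).toLinearMap)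

lemma halfR_intertwines_a :
    halfR e (DrinfeldDouble.ofDual F _) * halfComul (DrinfeldDouble.ofHopf F _) (a F N q) =
      halfComulOp (DrinfeldDouble.ofHopf F _) (a F N q) * halfR e (DrinfeldDouble.ofDual F _) := by
  rw [halfComul_a, halfComulOp_a, halfR, Finset.sum_mul, Finset.mul_sum]
  simp only [Algebra.TensorProduct.tmul_mul_tmul, ofHopf_a_mul_ofDual]
  rw [sum_tmul_conjFunctional, antipodeInv_a]
  simp only [← mul_assoc, a_mul_a_inv, one_mul]

/-- After transposing, the first two terms of `x eᵢ*` give `R Δ(x)`. The third becomes `-x a⁻¹ eᵢ a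
⊗ eᵢ* a`, which cancels the contribution of the summand `x ⊗ a` of `Δᵒᵖ(x)`. -/
lemma halfR_intertwines_x :
    halfR e (DrinfeldDouble.ofDual F _) * halfComul (DrinfeldDouble.ofHopf F _) (x F N q) =
      halfComulOp (DrinfeldDouble.ofHopf F _) (x F N q) * halfR e (DrinfeldDouble.ofDual F _) := by
  rw [halfComul_x, halfComulOp_x, halfR, Finset.sum_mul, Finset.mul_sum]
  simp only [add_mul, mul_add, Algebra.TensorProduct.tmul_mul_tmul, ofHopf_a_mul_ofDual,
    ofHopf_x_mul_ofDual, TensorProduct.tmul_add, Finset.sum_add_distrib]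
  have h1 := sum_tmul_conjFunctional e 1 (x F N q) 1 1
  have h2 := sum_tmul_conjFunctional e 1 (a F N q) 1 (DrinfeldDouble.ofHopf F _ (x F N q))
  have h3 := sum_tmul_conjFunctional e 1 (a F N q) (x F N q)
    (DrinfeldDouble.ofHopf F _ (a F N q))
  have h4 := sum_tmul_conjFunctional e (x F N q) (a F N q) (a F N q)
    (DrinfeldDouble.ofHopf F _ (a F N q))
  simp only [mul_one, one_mul, antipodeInv_one, antipodeInv_x, antipodeInv_a] at h1 h2 h3 h4 ⊢
  rw [h1, h2, h3, h4, add_assoc _ (∑ i, _ ⊗ₜ[F] (_ * DrinfeldDouble.ofHopf F _ (a F N q)))]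
  simp only [neg_mul, TensorProduct.neg_tmul, Finset.sum_neg_distrib, mul_assoc,
    neg_add_cancel, add_zero]

/-- Both coproducts are algebra maps, so the elements satisfying the relation form a subalgebra; it
contains `a` and `x`. -/
lemma halfR_intertwines (t : TaftAlgebra F N q) :
    halfR e (DrinfeldDouble.ofDual F _) * halfComul (DrinfeldDouble.ofHopf F _) t =
      halfComulOp (DrinfeldDouble.ofHopf F _) t * halfR e (DrinfeldDouble.ofDual F _) := by
  induction t using induction with
  | halg r =>
    rw [AlgHom.commutes, AlgHom.commutes]
    exact (Algebra.commutes r _).symm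
  | ha => exact halfR_intertwines_a e
  | hx => exact halfR_intertwines_x e
  | hmul s t hs ht => rw [map_mul, map_mul, ← mul_assoc, hs, mul_assoc, ht, mul_assoc]
  | hadd s t hs ht => rw [map_add, map_add, mul_add, add_mul, hs, ht]

/-! ### The scaling endomorphisms attached to the grading -/

variable (F N q)

/-- The endomorphism `a ↦ a`, `x ↦ μ x`, which multiplies `Aᵖ` by `μᵖ`. -/
noncomputable def scale (μ : F) : TaftAlgebra F N q →ₐ[F] TaftAlgebra F N q :=
  lift (a F N q) (μ • x F N q) (a_pow F N q) (by rw [smul_pow, x_pow, smul_zero])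
    (by rw [smul_mul_assoc, x_mul_a, mul_smul_comm, smul_comm])

omit [NeZero N] hq in
lemma scale_comp_scale (μ ν : F) :
    (scale F N q μ).comp (scale F N q ν) = scale F N q (μ * ν) := by
  apply algHom_ext
  · simp [scale]
  · simp [scale, smul_smul, mul_comm]

omit [NeZero N] hq in
lemma scale_monomial (μ : F) (i j : ℕ) :
    scale F N q μ (a F N q ^ i * x F N q ^ j) = μ ^ j • (a F N q ^ i * x F N q ^ j) := by
  simp [scale, smul_pow]

/-- Both sides are algebra maps, and each term of `Δ(x)` has exactly one factor `x`, hence picks up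
one `μ`. -/
lemma map_scale_comul (μ : F) :
    TensorProduct.map (scale F N q μ).toLinearMap (scale F N q μ).toLinearMap ∘ₗ
      Coalgebra.comul = Coalgebra.comul ∘ₗ (scale F N q μ).toLinearMap := by
  have h : (Algebra.TensorProduct.map (scale F N q μ) (scale F N q μ)).comp
      (Bialgebra.comulAlgHom F _) = (Bialgebra.comulAlgHom F _).comp (scale F N q μ) := by
    apply algHom_ext
    · simp [scale, comul_a]
    · simp [scale, comul_x, TensorProduct.smul_tmul', smul_add]
  exact congrArg AlgHom.toLinearMap h

end

end TaftAlgebra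

/-! ### The parametric R-matrix as a scaled canonical element -/

namespace TaftAlgebra

/-- The weight `μʲ` is the eigenvalue of `scale μ` on `aⁱxʲ`, which puts `R(μ)` in the form required
by `isYangBaxter_of_intertwines`. -/
lemma parametricR_monomialBasis (F : Type*) [Field F] (N : ℕ) (q : F) [NeZero N]
    [Fact (IsPrimitiveRoot q N)] (μ : F) :
    parametricR (monomialBasis F N q) μ = ∑ ij,
      DrinfeldDouble.ofHopf F _ (scale F N q μ (monomialBasis F N q ij)) ⊗ₜ[F]
        DrinfeldDouble.ofDual F _ (WithConv.toConv ((monomialBasis F N q).coord ij)) := by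
  rw [parametricR, Fintype.sum_prod_type]
  refine Finset.sum_congr rfl fun i _ => Finset.sum_congr rfl fun j _ => ?_
  rw [monomialBasis_apply, scale_monomial, map_smul, TensorProduct.smul_tmul']

lemma isParametricYangBaxter_parametricR (F : Type*) [Field F] (N : ℕ) (q : F) [NeZero N]
    [Fact (IsPrimitiveRoot q N)] :
    IsParametricYangBaxter (parametricR (monomialBasis F N q)) := by
  intro μ ν
  rw [parametricR_monomialBasis, parametricR_monomialBasis, parametricR_monomialBasis,
    ← scale_comp_scale]
  exact isYangBaxter_of_intertwines (monomialBasis F N q) _ _ (scale F N q μ) (scale F N q ν)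
    (map_scale_comul F N q ν) (halfR_intertwines _) _ fun _ => rfl

end TaftAlgebra

theorem mainTheorem3 {F : Type*} [Field F] (N : ℕ) [NeZero N] (q : F)
    [Fact (IsPrimitiveRoot q N)] :
    DirectSum.IsInternal (TaftAlgebra.grading F N q) ∧
    SetLike.GradedMonoid (TaftAlgebra.grading F N q) ∧
    (2 ≤ N → ∃ p : ℤ, p ≠ 0 ∧ TaftAlgebra.grading F N q p ≠ ⊥) ∧
    (∀ p : ℤ, ∀ t ∈ TaftAlgebra.grading F N q p,
      Coalgebra.comul (R := F) t ∈ ⨆ r : ℤ, LinearMap.range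
        (TensorProduct.map (TaftAlgebra.grading F N q r).subtype
          (TaftAlgebra.grading F N q (p - r)).subtype)) ∧
    ∃ e : Module.Basis (Fin N × Fin N) F (TaftAlgebra F N q),
      (∀ i j : Fin N, e (i, j) = TaftAlgebra.a F N q ^ (i : ℕ) * TaftAlgebra.x F N q ^ (j : ℕ)) ∧
      IsParametricYangBaxter (TaftAlgebra.parametricR e) := by
  exact ⟨TaftAlgebra.isInternal_grading F N q, TaftAlgebra.grading_gradedMonoid F N q,
    fun hN => ⟨1, one_ne_zero, TaftAlgebra.grading_one_ne_bot F N q hN⟩,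
    fun _ _ ht => TaftAlgebra.comul_mem_tensorGrading F N q ht,
    TaftAlgebra.monomialBasis F N q, TaftAlgebra.monomialBasis_apply F N q,
    TaftAlgebra.isParametricYangBaxter_parametricR F N q⟩
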